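/- **Quantum lower bound for minimizing the maximum of $N$ functions.** For $L_f,L_g,R,\epsilon>0$ write $$T=\min\Big\{\Big(\frac{L_fR}{\epsilon}\Big)^{2/3},\ \Big(\frac{L_gR^2}{\epsilon}\Big)^{1/3}\Big\},\qquad K=4\log T+\tfrac12\log N+4,$$ so that $T=(L_fR/\epsilon)^{2/3}$ whenever $L_g\ge L_f^2/\epsilon$. There is a universal constant $C>0$ such that the following holds. For all $L_f,L_g,R>0$, all $0<\epsilon<\min(L_fR,L_gR^2)$ and all integers $N\ge1$ there is a dimension $d_0$ such that for every $d\ge d_0$ and every quantum algorithm which makes $$q<\frac{C\,\sqrt N\,T}{K^2}$$ queries to the oracle $O_f$, there are convex functions $f_1,\dots,f_N:\mathbb R^d\to\mathbb R$, each $L_f$-Lipschitz and $L_g$-smooth (differentiable with $L_g$-Lipschitz gradient), such that, for $F_{\max}=\max_{i\in[N]}f_i$ and the ball $B=\{x\in\mathbb R^d:\|x\|\le R\}$, the output $x_{\rm out}\in B$ of the algorithm run with $O_f$ satisfies $$\Pr\Big[F_{\max}(x_{\rm out})-\min_{x\in B}F_{\max}(x)\ \ge\ \epsilon\Big]\ \ge\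 \frac23 .$$ If $\tau:=T/5$ satisfies $3\le\tau\le N/2$, one can take $d_0=\big\lceil \tau+32\,\tau^3\log(32\sqrt N\,\tau^5)\big\rceil$. Here $O_f$ is the unitary $|i\rangle|x\rangle|y\rangle\mapsto|i\rangle|x\rangle|y+f_i(x)\rangle$ on registers with orthonormal bases labelled by $i\in[N]$, $x\in B$, $y\in\mathbb R$. A quantum algorithm with $q$ queries applies $V_qO_fV_{q-1}O_f\cdots O_fV_0$ to a fixed basis state, where $V_0,\dots,V_q$ are arbitrary unitaries on the three registers and an arbitrary workspace which do not depend on $f$, measures in the computational basis, and computes $x_{\rm out}\in B$ from the outcome. In particular, for $L_g\ge L_f^2/\epsilon$, and hence for Lipschitz convex functions without a smoothness requirement, $\tilde\Omega(\sqrt N\,\epsilon^{-2/3})$ queries are necessary. -/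

import Mathlib

open scoped ENNReal

universe u

noncomputable section

namespace MinMaxLower

/-- Euclidean space `ℝ^d`. -/
abbrev Euc (d : ℕ) : Type := EuclideanSpace ℝ (Fin d)

/-- The closed ball `B_R^d(0)`, as a type: the possible contents of the point register. -/
abbrev Ball (d : ℕ) (R : ℝ) : Type := Metric.closedBall (0 : Euc d) R

/-! ### The optimization problem -/

/-- `g` is convex, `Lf`-Lipschitz and `Lg`-smooth (differentiable with `Lg`-Lipschitz gradient). -/
structure IsAdmissible {d : ℕ} (Lf Lg : ℝ) (g : Euc d → ℝ) : Prop where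
  convex : ConvexOn ℝ Set.univ g
  lipschitz : ∀ x y, |g x - g y| ≤ Lf * ‖x - y‖
  differentiable : Differentiable ℝ g
  smooth : ∀ x y, ‖gradient g x - gradient g y‖ ≤ Lg * ‖x - y‖

/-- `F_max(x) = max_i f_i(x)`. -/
def fMax {N d : ℕ} (f : Fin N → Euc d → ℝ) (x : Euc d) : ℝ := ⨆ i, f i x

/-- The suboptimality gap `F_max(x) - min_{y ∈ B_R(0)} F_max(y)`. -/
def gap {N d : ℕ} (R : ℝ) (f : Fin N → Euc d → ℝ) (x : Euc d) : ℝ :=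
  fMax f x - sInf (fMax f '' Metric.closedBall 0 R)

/-! ### Quantum query algorithms -/

/-- Labels of the computational basis: an index `i ∈ [N]`, a point `x ∈ B_R(0)`, a real value `y`,
and the contents `w : W` of an arbitrary workspace. -/
abbrev Label (N d : ℕ) (R : ℝ) (W : Type u) : Type u := Fin N × Ball d R × ℝ × W

/-- The Hilbert space with orthonormal basis `|s⟩`, `s : S`. -/
abbrev StateSpace (S : Type u) : Type u := lp (fun _ : S => ℂ) 2

theorem memℓp_comp_equiv {S : Type u} (e : S ≃ S) (ψ : StateSpace S) :
    Memℓp (E := fun _ : S => ℂ) (fun s => ψ (e s)) 2 := by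
  have h := (memℓp_gen_iff (p := (2 : ℝ≥0∞)) (by norm_num)).1 (lp.memℓp ψ)
  exact memℓp_gen (e.summable_iff.2 h)

/-- The unitary which permutes the basis by `|s⟩ ↦ |e s⟩`. -/
def permUnitary {S : Type u} (e : S ≃ S) : StateSpace S ≃ₗᵢ[ℂ] StateSpace S where
  toFun ψ := ⟨fun s => ψ (e.symm s), memℓp_comp_equiv e.symm ψ⟩
  invFun ψ := ⟨fun s => ψ (e s), memℓp_comp_equiv e ψ⟩
  map_add' ψ φ := by ext s; rfl
  map_smul' c ψ := by ext s; rfl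
  left_inv ψ := by ext s; simp
  right_inv ψ := by ext s; simp
  norm_map' ψ := by
    rw [lp.norm_eq_tsum_rpow (by norm_num), lp.norm_eq_tsum_rpow (by norm_num)]
    congr 1
    exact e.symm.tsum_eq (fun s => ‖ψ s‖ ^ (2 : ℝ≥0∞).toReal)

/-- The permutation `(i, x, y, w) ↦ (i, x, y + f_i(x), w)` of the basis labels. -/
def oracleEquiv {N d : ℕ} (R : ℝ) (W : Type u) (f : Fin N → Euc d → ℝ) :
    Label N d R W ≃ Label N d R W where
  toFun s := (s.1, s.2.1, s.2.2.1 + f s.1 s.2.1, s.2.2.2)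
  invFun s := (s.1, s.2.1, s.2.2.1 - f s.1 s.2.1, s.2.2.2)
  left_inv s := by simp
  right_inv s := by simp

/-- The quantum evaluation oracle `O_f : |i⟩|x⟩|y⟩|w⟩ ↦ |i⟩|x⟩|y + f_i(x)⟩|w⟩`. -/
def oracle {N d : ℕ} (R : ℝ) (W : Type u) (f : Fin N → Euc d → ℝ) :
    StateSpace (Label N d R W) ≃ₗᵢ[ℂ] StateSpace (Label N d R W) :=
  permUnitary (oracleEquiv R W f)

open Classical in
theorem oracle_single {N d : ℕ} (R : ℝ) (W : Type u) (f : Fin N → Euc d → ℝ)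
    (i : Fin N) (x : Ball d R) (y : ℝ) (w : W) :
    oracle R W f (lp.single 2 (i, x, y, w) 1) = lp.single 2 (i, x, y + f i x, w) 1 := by
  ext s
  change (lp.single 2 (i, x, y, w) (1 : ℂ) : StateSpace (Label N d R W))
    ((oracleEquiv R W f).symm s) = _
  by_cases h : s = (i, x, y + f i x, w)
  · subst h
    have : (oracleEquiv R W f).symm (i, x, y + f i x, w) = (i, x, y, w) := by
      simp [oracleEquiv]
    rw [this, lp.single_apply_self, lp.single_apply_self]
  · have h' : (oracleEquiv R W f).symm s ≠ (i, x, y, w) := by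
      intro hs
      apply h
      rw [Equiv.symm_apply_eq] at hs
      rw [hs]
      rfl
    rw [lp.single_apply_ne _ _ _ h', lp.single_apply_ne _ _ _ h]

/-- A quantum algorithm with `q` queries `V_q O_f V_{q-1} O_f ⋯ O_f V_1 O_f V_0`: an initial basis
state, unitaries `V_0, …, V_q` which do not depend on `f`, and a classical map that turns the
outcome of the final measurement in the computational basis into the output point. -/
structure QueryAlgorithm (N d : ℕ) (R : ℝ) (W : Type u) (q : ℕ) where
  init : Label N d R W
  unitary : Fin (q + 1) → (StateSpace (Label N d R W) ≃ₗᵢ[ℂ] StateSpace (Label N d R W))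
  output : Label N d R W → Ball d R

open Classical in
/-- The state `V_t O_f V_{t-1} ⋯ O_f V_0 |init⟩` after `t` queries. -/
def QueryAlgorithm.state {N d : ℕ} {R : ℝ} {W : Type u} {q : ℕ} (A : QueryAlgorithm N d R W q)
    (f : Fin N → Euc d → ℝ) : (t : ℕ) → t ≤ q → StateSpace (Label N d R W)
  | 0, _ => A.unitary 0 (lp.single 2 A.init 1)
  | t + 1, h =>
      A.unitary ⟨t + 1, Nat.lt_succ_of_le h⟩ (oracle R W f (A.state f t (Nat.le_of_succ_le h)))

open Classical in
/-- The probability that, when run with the oracle `O_f`, the algorithm outputs a point of `B`. -/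
def QueryAlgorithm.prob {N d : ℕ} {R : ℝ} {W : Type u} {q : ℕ} (A : QueryAlgorithm N d R W q)
    (f : Fin N → Euc d → ℝ) (B : Set (Euc d)) : ℝ :=
  ∑' s : Label N d R W, if (A.output s : Euc d) ∈ B then ‖A.state f q le_rfl s‖ ^ 2 else 0

/-! ### The parameters of the bound -/

/-- `min((Lf R / ε)^{2/3}, (Lg R² / ε)^{1/3})`. -/
def chainLength (Lf Lg R ε : ℝ) : ℝ :=
  min ((Lf * R / ε) ^ (2 / 3 : ℝ)) ((Lg * R ^ 2 / ε) ^ (1 / 3 : ℝ))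

/-- `4 log T + (1/2) log N + 4`. -/
def logFactor (T : ℝ) (N : ℕ) : ℝ := 4 * Real.log T + 1 / 2 * Real.log N + 4

/-- `τ + 32 τ³ log(32 √N τ⁵)`. -/
def dimBound (τ : ℝ) (N : ℕ) : ℝ :=
  τ + 32 * τ ^ 3 * Real.log (32 * √(N : ℝ) * τ ^ 5)

end MinMaxLower

end

noncomputable section
namespace MinMaxLower

/-! ### Mass of a state on a set of labels -/

section Mass

variable {S : Type u}

/-! The hard functions hide a chain. Draw random sign vectors v_0, …, v_{k-1} and a random
permutation of the indices. Link l is φ(⟨v_{l-1}, x⟩ - ⟨v_l, x⟩), where a height h replaces ⟨v_{-1},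
x⟩, and it is placed in the function named by the l-th value of the permutation; φ is a one-sided
Huber function behind a dead zone. Since the v_l are nearly orthogonal, for h = R/√(2k) some point
of the ball has correlation h with all of them (`exists_inner_eq`), and there every link vanishes.
At a point barely correlated with v_{k-1} the arguments of the links telescope to about h, so by
convexity their mean value is at least φ of about h/k (`le_sum_link`). As h/k is of order R/k^{3/2},
a gap ε is compatible with the regularity constraints for k of order T (`isAdmissible_and_le_gap`).

Hence success requires finding v_{k-1}. By Hoeffding's inequality a point chosen without knowledge
of a vector almost never leaves the dead zone, so given the first j pieces of data a query can
notice only link j, and only by naming its index, which has conditional probability at most 2/N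
(`isHiddenChain_chainFun`).

The quantum part is a hybrid argument over blocks of m queries, m about √N/8. Let D_i be the error,
over one block, of keeping only i links beyond those known at its start. Replacing oracles one query
at a time gives D_{i+1} ≤ θ D_i + η with θ ≤ 1/2 and η negligible
(`IsHiddenChain.totalNorm_run_sub_le`). So L = O(log T) links per block suffice up to error T^{-2},
and after n blocks with nL < k the state is almost independent of v_{k-1}
(`IsHiddenChain.exists_approx`). Averaging fixes one instance (`exists_hard_instance`). The number
nm of queries is of order √N T / K, a factor K more than needed.

Outside the main range there are simpler instances: one hidden linear function for T < 15; a chain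
of a single Huber link for moderate T; and, when N is too small for distinct indices, all links in
every function, with one link revealed per query. -/

theorem hasSum_norm_sq (ψ : StateSpace S) : HasSum (fun s => ‖ψ s‖ ^ 2) (‖ψ‖ ^ 2) := by
  have h := lp.hasSum_norm (p := (2 : ℝ≥0∞)) (by norm_num) ψ
  simpa using h

open Classical in
/-- The projection onto the span of the basis states with labels in `B`. -/
def proj (B : Set S) (ψ : StateSpace S) : StateSpace S :=
  ⟨fun s => if s ∈ B then ψ s else 0, by
    have h := (memℓp_gen_iff (p := (2 : ℝ≥0∞)) (by norm_num)).1 (lp.memℓp ψ)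
    refine memℓp_gen (h.of_nonneg_of_le (fun s => by positivity) fun s => ?_)
    by_cases hs : s ∈ B <;> simp [hs]⟩

open Classical in
theorem proj_apply (B : Set S) (ψ : StateSpace S) (s : S) :
    proj B ψ s = if s ∈ B then ψ s else 0 := rfl

open Classical in
theorem hasSum_proj (B : Set S) (ψ : StateSpace S) :
    HasSum (fun s => if s ∈ B then ‖ψ s‖ ^ 2 else 0) (‖proj B ψ‖ ^ 2) := by
  convert hasSum_norm_sq (proj B ψ) using 2 with s
  by_cases hs : s ∈ B <;> simp [proj_apply, hs]

theorem proj_add (B : Set S) (ψ φ : StateSpace S) : proj B (ψ + φ) = proj B ψ + proj B φ := by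
  ext s
  by_cases hs : s ∈ B <;> simp [proj_apply, hs]

theorem norm_proj_le (B : Set S) (ψ : StateSpace S) : ‖proj B ψ‖ ≤ ‖ψ‖ := by
  refine le_of_sq_le_sq ?_ (norm_nonneg _)
  classical
  refine hasSum_le (fun s => ?_) (hasSum_proj B ψ) (hasSum_norm_sq ψ)
  by_cases hs : s ∈ B <;> simp [hs]

end Mass

/-! ### Rare events -/

section Rare

variable {Ω : Type*} [Fintype Ω] {S : Type u}

open Classical in
/-- Under the uniform distribution on `Ω`, the event `E` has conditional probability at most `p`
given the information which `r` preserves. -/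
def RareGiven (r : Ω → Ω → Prop) (p : ℝ) (E : Ω → Prop) : Prop :=
  ∀ G : Ω → ℝ, (∀ ω, 0 ≤ G ω) → (∀ ω ω', r ω ω' → G ω = G ω') →
    ∑ ω, (if E ω then G ω else 0) ≤ p * ∑ ω, G ω

theorem RareGiven.mono {r : Ω → Ω → Prop} {p p' : ℝ} {E E' : Ω → Prop} (h : RareGiven r p E)
    (hp : p ≤ p') (hE : ∀ ω, E' ω → E ω) : RareGiven r p' E' := by
  classical
  intro G hG hr
  refine le_trans (Finset.sum_le_sum fun ω _ => ?_) ((h G hG hr).trans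
    (mul_le_mul_of_nonneg_right hp (Finset.sum_nonneg fun ω _ => hG ω)))
  by_cases h1 : E' ω
  · simp [h1, hE ω h1]
  · by_cases h2 : E ω <;> simp [h1, h2, hG]

theorem RareGiven.or {r : Ω → Ω → Prop} {p q : ℝ} {E F : Ω → Prop} (hE : RareGiven r p E)
    (hF : RareGiven r q F) : RareGiven r (p + q) (fun ω => E ω ∨ F ω) := by
  classical
  intro G hG hr
  rw [add_mul]
  refine le_trans ?_ (add_le_add (hE G hG hr) (hF G hG hr))
  rw [← Finset.sum_add_distrib]
  refine Finset.sum_le_sum fun ω _ => ?_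
  by_cases h1 : E ω <;> by_cases h2 : F ω <;> simp [h1, h2, hG]

theorem RareGiven.false (r : Ω → Ω → Prop) {E : Ω → Prop} (hE : ∀ ω, ¬ E ω) :
    RareGiven r 0 E := by
  classical
  intro G _ _
  simp [hE]

theorem RareGiven.exists_mem {r : Ω → Ω → Prop} {p : ℝ} {ι : Type*} (t : Finset ι)
    {E : ι → Ω → Prop} (h : ∀ i ∈ t, RareGiven r p (E i)) :
    RareGiven r (t.card * p) (fun ω => ∃ i ∈ t, E i ω) := by
  classical
  induction t using Finset.induction_on with
  | empty => simpa using RareGiven.false r (by simp)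
  | insert a t ha ih =>
    have h1 := (h a (by simp)).or (ih fun i hi => h i (by simp [hi]))
    refine h1.mono (le_of_eq ?_) fun ω hω => ?_
    · rw [Finset.card_insert_of_notMem ha]; push_cast; ring
    · simpa using hω

/-- The `L²` norm of a family of states over `Ω`, unnormalized. -/
def totalNorm (ψ : Ω → StateSpace S) : ℝ :=
  ‖(WithLp.toLp 2 ψ : PiLp 2 fun _ : Ω => StateSpace S)‖

theorem totalNorm_nonneg (ψ : Ω → StateSpace S) : 0 ≤ totalNorm ψ := norm_nonneg _

theorem totalNorm_sq (ψ : Ω → StateSpace S) : totalNorm ψ ^ 2 = ∑ ω, ‖ψ ω‖ ^ 2 :=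
  PiLp.norm_sq_eq_of_L2 _ _

theorem totalNorm_add_le (ψ φ : Ω → StateSpace S) :
    totalNorm (fun ω => ψ ω + φ ω) ≤ totalNorm ψ + totalNorm φ :=
  norm_add_le (WithLp.toLp 2 ψ : PiLp 2 fun _ : Ω => StateSpace S) (WithLp.toLp 2 φ)

theorem totalNorm_le_of_norm_le {ψ φ : Ω → StateSpace S} {c : ℝ} (hc : 0 ≤ c)
    (h : ∀ ω, ‖ψ ω‖ ≤ c * ‖φ ω‖) : totalNorm ψ ≤ c * totalNorm φ := by
  refine le_of_sq_le_sq ?_ (mul_nonneg hc (totalNorm_nonneg _))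
  rw [mul_pow, totalNorm_sq, totalNorm_sq, Finset.mul_sum]
  refine Finset.sum_le_sum fun ω _ => ?_
  rw [← mul_pow]
  exact pow_le_pow_left₀ (norm_nonneg _) (h ω) 2

theorem totalNorm_congr {ψ φ : Ω → StateSpace S} (h : ∀ ω, ‖ψ ω‖ = ‖φ ω‖) :
    totalNorm ψ = totalNorm φ := by
  have : totalNorm ψ ^ 2 = totalNorm φ ^ 2 := by simp [totalNorm_sq, h]
  exact (sq_eq_sq₀ (totalNorm_nonneg _) (totalNorm_nonneg _)).1 this

theorem totalNorm_of_norm_eq_one {ψ : Ω → StateSpace S} (h : ∀ ω, ‖ψ ω‖ = 1) :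
    totalNorm ψ = √(Fintype.card Ω) := by
  rw [← Real.sqrt_sq (totalNorm_nonneg ψ), totalNorm_sq]
  simp [h]

/-- A family of states which depends only on the information preserved by `r` has little mass on
labels which are rare given that information. -/
theorem totalNorm_proj_le {r : Ω → Ω → Prop} {p : ℝ} (hp : 0 ≤ p) {B : Ω → Set S}
    (hB : ∀ s, RareGiven r p (fun ω => s ∈ B ω)) {ψ : Ω → StateSpace S}
    (hψ : ∀ ω ω', r ω ω' → ψ ω = ψ ω') :
    totalNorm (fun ω => proj (B ω) (ψ ω)) ≤ √p * totalNorm ψ := by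
  classical
  refine le_of_sq_le_sq ?_ (mul_nonneg (Real.sqrt_nonneg _) (totalNorm_nonneg _))
  rw [mul_pow, totalNorm_sq, totalNorm_sq, Real.sq_sqrt hp]
  have h1 := hasSum_sum (s := Finset.univ) fun ω (_ : ω ∈ Finset.univ) => hasSum_proj (B ω) (ψ ω)
  have h2 := (hasSum_sum (s := Finset.univ) fun ω (_ : ω ∈ Finset.univ) =>
    hasSum_norm_sq (ψ ω)).mul_left p
  refine hasSum_le (fun s => ?_) h1 h2
  -- The bound holds label by label: the squared amplitude at `s` is a weight invariant under `r`,
  -- against which rarity can be tested.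
  exact hB s (fun ω => ‖ψ ω s‖ ^ 2) (fun ω => by positivity) fun ω ω' h => by rw [hψ ω ω' h]

end Rare

/-! ### Replacing one oracle by another -/

section Oracle

variable {N d : ℕ} {R : ℝ} {W : Type u}

/-- Oracles do not change the index and point registers, so the set of labels where `f` and `g`
disagree is invariant under both. Off this set they act alike, and each contributes the projected
mass once. -/
theorem norm_oracle_sub_le (f g : Fin N → Euc d → ℝ) (ψ : StateSpace (Label N d R W)) :
    ‖oracle R W f ψ - oracle R W g ψ‖
      ≤ 2 * ‖proj {s | f s.1 s.2.1 ≠ g s.1 s.2.1} ψ‖ := by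
  classical
  set B : Set (Label N d R W) := {s | f s.1 s.2.1 ≠ g s.1 s.2.1} with hB
  have key : oracle R W f (ψ - proj B ψ) = oracle R W g (ψ - proj B ψ) := by
    ext s
    change (ψ - proj B ψ) ((oracleEquiv R W f).symm s) = (ψ - proj B ψ) ((oracleEquiv R W g).symm s)
    by_cases hs : f s.1 s.2.1 = g s.1 s.2.1
    · have : (oracleEquiv R W f).symm s = (oracleEquiv R W g).symm s := by
        simp [oracleEquiv, hs]
      rw [this]
    · have h1 : (oracleEquiv R W f).symm s ∈ B := hs
      have h2 : (oracleEquiv R W g).symm s ∈ B := hs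
      simp [proj_apply, h1, h2]
  rw [map_sub, map_sub] at key
  have h3 : oracle R W f ψ - oracle R W g ψ = oracle R W f (proj B ψ) - oracle R W g (proj B ψ) :=
    sub_eq_sub_iff_sub_eq_sub.1 key
  rw [h3]
  refine (norm_sub_le _ _).trans (le_of_eq ?_)
  rw [LinearIsometryEquiv.norm_map, LinearIsometryEquiv.norm_map]
  ring

variable {Ω : Type*} [Fintype Ω]

theorem totalNorm_oracle_sub_le {r : Ω → Ω → Prop} {p : ℝ} (hp : 0 ≤ p)
    {f g : Ω → Fin N → Euc d → ℝ}
    (hfg : ∀ i (x : Ball d R), RareGiven r p (fun ω => f ω i x ≠ g ω i x))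
    {ψ : Ω → StateSpace (Label N d R W)} (hψ : ∀ ω ω', r ω ω' → ψ ω = ψ ω') :
    totalNorm (fun ω => oracle R W (f ω) (ψ ω) - oracle R W (g ω) (ψ ω))
      ≤ 2 * √p * totalNorm ψ := by
  refine (totalNorm_le_of_norm_le zero_le_two fun ω => norm_oracle_sub_le _ _ _).trans ?_
  rw [mul_assoc]
  refine mul_le_mul_of_nonneg_left (totalNorm_proj_le (r := r)
    (B := fun ω => {s : Label N d R W | f ω s.1 s.2.1 ≠ g ω s.1 s.2.1}) hp ?_ hψ) zero_le_two
  exact fun s => hfg s.1 s.2.1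

/-- Apply `O_f` and `V (t + 1)`, then `O_f` and `V (t + 2)`, and so on, `s` times. -/
def run (V : ℕ → (StateSpace (Label N d R W) ≃ₗᵢ[ℂ] StateSpace (Label N d R W)))
    (f : Fin N → Euc d → ℝ) (t : ℕ) (φ : StateSpace (Label N d R W)) :
    ℕ → StateSpace (Label N d R W)
  | 0 => φ
  | s + 1 => V (t + s + 1) (oracle R W f (run V f t φ s))

variable (V : ℕ → (StateSpace (Label N d R W) ≃ₗᵢ[ℂ] StateSpace (Label N d R W)))

theorem norm_run (f : Fin N → Euc d → ℝ) (t : ℕ) (φ : StateSpace (Label N d R W)) (s : ℕ) :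
    ‖run V f t φ s‖ = ‖φ‖ := by
  induction s with
  | zero => rfl
  | succ s ih => rw [run, LinearIsometryEquiv.norm_map, LinearIsometryEquiv.norm_map, ih]

theorem run_add (f : Fin N → Euc d → ℝ) (t : ℕ) (φ : StateSpace (Label N d R W)) (a b : ℕ) :
    run V f t φ (a + b) = run V f (t + a) (run V f t φ a) b := by
  induction b with
  | zero => rfl
  | succ b ih => rw [← add_assoc, run, run, ih, add_assoc t a b]

theorem norm_run_sub (f : Fin N → Euc d → ℝ) (t : ℕ) (φ φ' : StateSpace (Label N d R W)) (s : ℕ) :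
    ‖run V f t φ s - run V f t φ' s‖ = ‖φ - φ'‖ := by
  induction s with
  | zero => rfl
  | succ s ih =>
    rw [run, run, ← map_sub, ← map_sub, LinearIsometryEquiv.norm_map, LinearIsometryEquiv.norm_map,
      ih]

end Oracle

/-! ### The hybrid argument -/

section Hybrid

variable {N d : ℕ} {R : ℝ} {W : Type u} {Ω : Type*} [Fintype Ω]

/-- `f 0, …, f k` are random instances, `f j` is determined by the first `j` pieces of hidden
data, which `r j` preserves. Given these, the values of `f n` and `f j` differ at a fixed place
with probability at most `p`, and those of `f n` and `f (j + 1)` with probability at most `δ`. -/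
structure IsHiddenChain (R : ℝ) (k : ℕ) (r : ℕ → Ω → Ω → Prop)
    (f : ℕ → Ω → Fin N → Euc d → ℝ) (p δ : ℝ) : Prop where
  mono : ∀ j ω ω', r (j + 1) ω ω' → r j ω ω'
  resp : ∀ j ω ω', r j ω ω' → f j ω = f j ω'
  next : ∀ j n, j ≤ n → n ≤ k → ∀ i (x : Ball d R),
    RareGiven (r j) p (fun ω => f n ω i x ≠ f j ω i x)
  far : ∀ j n, j + 1 ≤ n → n ≤ k → ∀ i (x : Ball d R),
    RareGiven (r j) δ (fun ω => f n ω i x ≠ f (j + 1) ω i x)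

theorem IsHiddenChain.mono_le {k : ℕ} {r : ℕ → Ω → Ω → Prop} {f : ℕ → Ω → Fin N → Euc d → ℝ}
    {p δ : ℝ} (h : IsHiddenChain R k r f p δ) {i j : ℕ} (hij : i ≤ j) {ω ω' : Ω}
    (hr : r j ω ω') : r i ω ω' := by
  induction hij with
  | refl => exact hr
  | step _ ih => exact ih (h.mono _ _ _ hr)

variable (V : ℕ → (StateSpace (Label N d R W) ≃ₗᵢ[ℂ] StateSpace (Label N d R W)))

/-- Unitaries preserve the accumulated error, so each query only adds its own discrepancy. That is
measured on the run of `g`, which in the applications depends on less hidden data than the run of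
`f`. -/
theorem totalNorm_run_sub_le {f g : Ω → Fin N → Euc d → ℝ} (t : ℕ)
    (φ : Ω → StateSpace (Label N d R W)) {c : ℝ} (m : ℕ)
    (hc : ∀ s < m, totalNorm (fun ω => oracle R W (f ω) (run V (g ω) t (φ ω) s)
      - oracle R W (g ω) (run V (g ω) t (φ ω) s)) ≤ c) :
    ∀ s ≤ m, totalNorm (fun ω => run V (f ω) t (φ ω) s - run V (g ω) t (φ ω) s) ≤ s * c := by
  intro s hs
  induction s with
  | zero =>
    have : totalNorm (fun ω => run V (f ω) t (φ ω) 0 - run V (g ω) t (φ ω) 0) ^ 2 = 0 := by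
      simp [totalNorm_sq, run]
    rw [pow_eq_zero_iff two_ne_zero] at this
    simp [this]
  | succ s ih =>
    have h1 := totalNorm_add_le
      (fun ω => oracle R W (f ω) (run V (f ω) t (φ ω) s - run V (g ω) t (φ ω) s))
      (fun ω => oracle R W (f ω) (run V (g ω) t (φ ω) s)
        - oracle R W (g ω) (run V (g ω) t (φ ω) s))
    rw [totalNorm_congr (ψ := fun ω => oracle R W (f ω) _) (φ := fun ω =>
      run V (f ω) t (φ ω) s - run V (g ω) t (φ ω) s)
      fun ω => LinearIsometryEquiv.norm_map _ _] at h1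
    have h2 := ih (Nat.le_of_succ_le hs)
    have h3 := hc s hs
    push_cast
    rw [totalNorm_congr (φ := fun ω =>
      oracle R W (f ω) (run V (f ω) t (φ ω) s - run V (g ω) t (φ ω) s)
      + (oracle R W (f ω) (run V (g ω) t (φ ω) s)
        - oracle R W (g ω) (run V (g ω) t (φ ω) s)))]
    · linarith
    · intro ω
      rw [run, run, ← map_sub, LinearIsometryEquiv.norm_map, map_sub, sub_add_sub_cancel]

/-- The error after one block of queries in which `i` further levels may be entered. -/
def blockError (θ η : ℝ) : ℕ → ℝ
  | 0 => θ
  | i + 1 => θ * blockError θ η i + η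

/-- Each step at least halves the old error and adds `η`; the errors `η` sum to at most `2 * η`. -/
theorem blockError_le {θ η : ℝ} (h0 : 0 ≤ θ) (h1 : θ ≤ 1 / 2) (hη : 0 ≤ η) (i : ℕ) :
    blockError θ η i ≤ (1 / 2) ^ (i + 1) + 2 * η := by
  induction i with
  | zero => simp only [blockError]; norm_num at *; linarith
  | succ i ih =>
    rw [blockError]
    have hb : 0 ≤ ((1 / 2) ^ (i + 1) + 2 * η : ℝ) := by positivity
    calc θ * blockError θ η i + η ≤ θ * ((1 / 2) ^ (i + 1) + 2 * η) + η := by gcongr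
      _ ≤ 1 / 2 * ((1 / 2) ^ (i + 1) + 2 * η) + η := by gcongr
      _ = _ := by ring

variable {V}

/-- Reaching one level deeper costs another factor θ: only the part of the state that already
depends on the newest piece of data can find the next link with probability `p`; the rest would have
to skip a level, which has probability `δ`. -/
theorem IsHiddenChain.totalNorm_run_sub_le {k : ℕ} {r : ℕ → Ω → Ω → Prop}
    {f : ℕ → Ω → Fin N → Euc d → ℝ} {p δ : ℝ} (h : IsHiddenChain R k r f p δ) (hp : 0 ≤ p)
    (hδ : 0 ≤ δ) {J : ℕ} {φ : Ω → StateSpace (Label N d R W)}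
    (hφ : ∀ ω ω', r J ω ω' → φ ω = φ ω') (hφ1 : ∀ ω, ‖φ ω‖ = 1) (t m i : ℕ) :
    ∀ n, J + i ≤ n → n ≤ k → ∀ s ≤ m,
      totalNorm (fun ω => run V (f n ω) t (φ ω) s - run V (f (J + i) ω) t (φ ω) s)
        ≤ blockError (2 * m * √p) (2 * m * √δ) i * √(Fintype.card Ω) := by
  have hrun : ∀ i s ω ω', r (J + i) ω ω' →
      run V (f (J + i) ω) t (φ ω) s = run V (f (J + i) ω') t (φ ω') s := by
    intro i s ω ω' hr
    rw [h.resp _ _ _ hr, hφ _ _ (h.mono_le (Nat.le_add_right _ _) hr)]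
  have hrun1 : ∀ i s, totalNorm (fun ω => run V (f (J + i) ω) t (φ ω) s) = √(Fintype.card Ω) :=
    fun i s => totalNorm_of_norm_eq_one fun ω => by rw [norm_run, hφ1]
  have hs0 : 0 ≤ √(Fintype.card Ω : ℝ) := Real.sqrt_nonneg _
  have hp0 := Real.sqrt_nonneg p
  have hδ0 := Real.sqrt_nonneg δ
  induction i with
  | zero =>
    intro n hJn hnk s hs
    have h1 := MinMaxLower.totalNorm_run_sub_le V (f := f n) (g := f (J + 0)) t φ
      (c := 2 * √p * √(Fintype.card Ω)) m (fun s _ => by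
        have := totalNorm_oracle_sub_le (R := R) (W := W) hp (h.next (J + 0) n hJn hnk)
          (hrun 0 s)
        rwa [hrun1] at this) s hs
    have hsm : (s : ℝ) ≤ m := by exact_mod_cast hs
    calc _ ≤ _ := h1
      _ ≤ m * (2 * √p * √(Fintype.card Ω)) := by gcongr
      _ = _ := by rw [blockError]; ring
  | succ i ih =>
    intro n hJn hnk s hs
    have h1 := MinMaxLower.totalNorm_run_sub_le V (f := f n) (g := f (J + (i + 1))) t φ
      (c := 2 * √p * (blockError (2 * m * √p) (2 * m * √δ) i * √(Fintype.card Ω))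
        + 2 * √δ * √(Fintype.card Ω)) m (fun s hs => by
        -- The state is split as (run at level i+1 minus run at level i) plus run at level i. The
        -- first part is small by induction and gains a further `√p`.
        have e1 := totalNorm_oracle_sub_le (R := R) (W := W) hp (h.next (J + (i + 1)) n hJn hnk)
          (ψ := fun ω => run V (f (J + (i + 1)) ω) t (φ ω) s - run V (f (J + i) ω) t (φ ω) s)
          (fun ω ω' hr => by
            rw [hrun (i + 1) s ω ω' hr, hrun i s ω ω' (h.mono_le (by omega) hr)])
        -- The second part knows one piece of data less, so the sharper bound `far` applies.
        have e2 := totalNorm_oracle_sub_le (R := R) (W := W) hδ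
          (h.far (J + i) n (by omega) hnk) (hrun i s)
        rw [hrun1] at e2
        have e3 := ih (J + (i + 1)) (by omega) (hJn.trans hnk) s hs.le
        have e4 := totalNorm_add_le _ _ |>.trans (add_le_add e1 e2)
        refine le_trans (le_of_eq (totalNorm_congr fun ω => ?_))
          (e4.trans (add_le_add_left (mul_le_mul_of_nonneg_left e3 (by positivity)) _))
        congr 1
        simp only [map_sub, add_assoc]
        abel) s hs
    have hsm : (s : ℝ) ≤ m := by exact_mod_cast hs
    have hc := (totalNorm_nonneg _).trans (ih (J + i) le_rfl (by omega) 0 (Nat.zero_le _))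
    calc _ ≤ _ := h1
      _ ≤ m * (2 * √p * (blockError (2 * m * √p) (2 * m * √δ) i * √(Fintype.card Ω))
        + 2 * √δ * √(Fintype.card Ω)) := by gcongr
      _ = _ := by rw [blockError]; ring

/-- Chaining blocks of at most `m` queries, each of which enters `L` levels up to an error `β`. -/
theorem IsHiddenChain.exists_approx {k : ℕ} {r : ℕ → Ω → Ω → Prop}
    {f : ℕ → Ω → Fin N → Euc d → ℝ} {p δ : ℝ} (h : IsHiddenChain R k r f p δ)
    {L m : ℕ} {β : ℝ} (hβ : 0 ≤ β) {ψ₀ : StateSpace (Label N d R W)} (hψ₀ : ‖ψ₀‖ = 1)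
    (hblock : ∀ J t, J + L ≤ k → ∀ φ : Ω → StateSpace (Label N d R W),
      (∀ ω ω', r J ω ω' → φ ω = φ ω') → (∀ ω, ‖φ ω‖ = 1) → ∀ s ≤ m,
      totalNorm (fun ω => run V (f k ω) t (φ ω) s - run V (f (J + L) ω) t (φ ω) s)
        ≤ β * √(Fintype.card Ω)) (n : ℕ) (hn : n * L ≤ k) :
    ∀ t ≤ n * m, ∃ φ : Ω → StateSpace (Label N d R W),
      (∀ ω ω', r (n * L) ω ω' → φ ω = φ ω') ∧ (∀ ω, ‖φ ω‖ = 1) ∧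
      totalNorm (fun ω => run V (f k ω) 0 ψ₀ t - φ ω) ≤ n * β * √(Fintype.card Ω) := by
  have hs0 : 0 ≤ √(Fintype.card Ω : ℝ) := Real.sqrt_nonneg _
  induction n with
  | zero =>
    intro t ht
    obtain rfl : t = 0 := by simpa using ht
    refine ⟨fun _ => ψ₀, fun _ _ _ => rfl, fun _ => hψ₀, ?_⟩
    have : totalNorm (fun ω => run V (f k ω) 0 ψ₀ 0 - ψ₀) ^ 2 = 0 := by
      simp [totalNorm_sq, run]
    rw [pow_eq_zero_iff two_ne_zero] at this
    simp [this]
  | succ n ih =>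
    intro t ht
    rw [Nat.succ_mul] at hn ht
    by_cases htn : t ≤ n * m
    · obtain ⟨φ, h1, h2, h3⟩ := ih (by omega) t htn
      refine ⟨φ, fun ω ω' hr => h1 _ _ (h.mono_le (by rw [Nat.succ_mul]; omega) hr), h2,
        h3.trans ?_⟩
      push_cast
      gcongr
      linarith
    -- The new block restarts from the approximating state at time `n * m`. The old error is carried
    -- along isometrically, and the new approximation uses the oracle with `L` more links.
    · obtain ⟨s, rfl⟩ := Nat.exists_eq_add_of_le (not_le.1 htn).le
      obtain ⟨φ, h1, h2, h3⟩ := ih (by omega) (n * m) le_rfl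
      refine ⟨fun ω => run V (f (n * L + L) ω) (n * m) (φ ω) s, fun ω ω' hr => ?_,
        fun ω => by rw [norm_run, h2], ?_⟩
      · rw [Nat.succ_mul] at hr
        simp only
        rw [h.resp _ _ _ hr, h1 _ _ (h.mono_le (by omega) hr)]
      · have e1 := hblock (n * L) (n * m) hn φ h1 h2 s (by omega)
        have e2 := totalNorm_add_le
          (fun ω => run V (f k ω) (n * m) (run V (f k ω) 0 ψ₀ (n * m)) s
            - run V (f k ω) (n * m) (φ ω) s)
          (fun ω => run V (f k ω) (n * m) (φ ω) s - run V (f (n * L + L) ω) (n * m) (φ ω) s)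
        rw [totalNorm_congr (φ := fun ω => run V (f k ω) 0 ψ₀ (n * m) - φ ω)
          fun ω => norm_run_sub V _ _ _ _ _] at e2
        simp only [sub_add_sub_cancel] at e2
        have e3 : ∀ ω, run V (f k ω) 0 ψ₀ (n * m + s)
            = run V (f k ω) (n * m) (run V (f k ω) 0 ψ₀ (n * m)) s := fun ω => by
          rw [run_add, Nat.zero_add]
        simp only [e3]
        push_cast
        linarith

/-- If a family of states is close to one which only depends on the information preserved by `r`,
then most outcomes avoid places which are rare given that information. -/
theorem sum_norm_proj_sq_le {S : Type u} {r : Ω → Ω → Prop} {δ β : ℝ} (hδ : 0 ≤ δ) {B : Ω → Set S}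
    (hB : ∀ s, RareGiven r δ (fun ω => s ∈ B ω)) {ψ φ : Ω → StateSpace S}
    (hφ : ∀ ω ω', r ω ω' → φ ω = φ ω') (hφ1 : ∀ ω, ‖φ ω‖ = 1)
    (hψ : totalNorm (fun ω => ψ ω - φ ω) ≤ β * √(Fintype.card Ω)) :
    ∑ ω, ‖proj (B ω) (ψ ω)‖ ^ 2 ≤ (√δ + β) ^ 2 * Fintype.card Ω := by
  have h1 := totalNorm_proj_le hδ hB hφ
  rw [totalNorm_of_norm_eq_one hφ1] at h1
  have h2 : totalNorm (fun ω => proj (B ω) (ψ ω - φ ω)) ≤ 1 * totalNorm (fun ω => ψ ω - φ ω) :=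
    totalNorm_le_of_norm_le zero_le_one fun ω => by rw [one_mul]; exact norm_proj_le _ _
  have h3 := totalNorm_add_le (fun ω => proj (B ω) (φ ω)) (fun ω => proj (B ω) (ψ ω - φ ω))
  simp only [← proj_add, add_sub_cancel] at h3
  rw [← totalNorm_sq, ← Real.sq_sqrt (Nat.cast_nonneg (Fintype.card Ω)), ← mul_pow]
  refine pow_le_pow_left₀ (totalNorm_nonneg _) ?_ 2
  linarith

end Hybrid

/-! ### Query algorithms -/

section Algorithm

variable {N d : ℕ} {R : ℝ} {W : Type u} {q : ℕ}

/-- The unitaries of an algorithm, continued by the identity. -/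
def QueryAlgorithm.unitaries (A : QueryAlgorithm N d R W q) (t : ℕ) :
    StateSpace (Label N d R W) ≃ₗᵢ[ℂ] StateSpace (Label N d R W) :=
  if h : t < q + 1 then A.unitary ⟨t, h⟩ else LinearIsometryEquiv.refl ℂ _

open Classical in
/-- The state before the first query. -/
def QueryAlgorithm.start (A : QueryAlgorithm N d R W q) : StateSpace (Label N d R W) :=
  A.unitary 0 (lp.single 2 A.init 1)

theorem QueryAlgorithm.norm_start (A : QueryAlgorithm N d R W q) : ‖A.start‖ = 1 := by
  classical
  rw [start, LinearIsometryEquiv.norm_map, lp.norm_single (by norm_num)]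
  simp

theorem QueryAlgorithm.state_eq_run (A : QueryAlgorithm N d R W q) (f : Fin N → Euc d → ℝ) :
    ∀ t (h : t ≤ q), A.state f t h = run A.unitaries f 0 A.start t
  | 0, _ => rfl
  | t + 1, h => by
    have ht : t + 1 < q + 1 := by omega
    rw [state, run, state_eq_run A f t (by omega), Nat.zero_add, unitaries, dif_pos ht]

theorem QueryAlgorithm.prob_add_norm_proj_sq (A : QueryAlgorithm N d R W q)
    (f : Fin N → Euc d → ℝ) (B : Set (Euc d)) :
    A.prob f B + ‖proj {s | (A.output s : Euc d) ∉ B} (run A.unitaries f 0 A.start q)‖ ^ 2 = 1 := by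
  classical
  have h1 := hasSum_proj {s | (A.output s : Euc d) ∈ B} (run A.unitaries f 0 A.start q)
  have h2 := hasSum_proj {s | (A.output s : Euc d) ∉ B} (run A.unitaries f 0 A.start q)
  have h3 : A.prob f B
      = ‖proj {s | (A.output s : Euc d) ∈ B} (run A.unitaries f 0 A.start q)‖ ^ 2 := by
    rw [← h1.tsum_eq, prob]
    refine tsum_congr fun s => ?_
    rw [state_eq_run]
    rfl
  have h4 := hasSum_norm_sq (run A.unitaries f 0 A.start q)
  rw [norm_run, norm_start, one_pow] at h4
  rw [h3]
  refine ((h1.add h2).congr_fun fun s => ?_).unique h4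
  by_cases hs : (A.output s : Euc d) ∈ B <;> simp [hs]

end Algorithm

/-! ### Random sign vectors -/

section Signs

variable {d : ℕ}

/-- The sign encoded by a bit. -/
def sgn (b : Bool) : ℝ := if b then 1 else -1

theorem sgn_sq (b : Bool) : sgn b ^ 2 = 1 := by cases b <;> simp [sgn]

/-- The unit vector with entries `± 1 / √d`. -/
def signVec (e : Fin d → Bool) : Euc d := WithLp.toLp 2 fun s => sgn (e s) / √d

theorem inner_signVec (e : Fin d → Bool) (x : Euc d) :
    inner ℝ (signVec e) x = (∑ s, sgn (e s) * x s) / √d := by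
  rw [PiLp.inner_apply, Finset.sum_div]
  refine Finset.sum_congr rfl fun s _ => ?_
  simp [signVec]
  ring

theorem norm_signVec (hd : 0 < d) (e : Fin d → Bool) : ‖signVec e‖ = 1 := by
  have h : ‖signVec e‖ ^ 2 = 1 := by
    rw [EuclideanSpace.norm_sq_eq]
    simp only [signVec, Real.norm_eq_abs, sq_abs, div_pow, sgn_sq, Real.sq_sqrt (Nat.cast_nonneg d)]
    have : (d : ℝ) ≠ 0 := by positivity
    simp [this]
  rwa [pow_eq_one_iff_of_nonneg (norm_nonneg _) two_ne_zero] at h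

/-- Independence of the signs factorizes the sum, and cosh c ≤ exp(c²/2) bounds each factor. -/
theorem sum_exp_sgn_le (c : Fin d → ℝ) :
    ∑ e : Fin d → Bool, Real.exp (∑ s, sgn (e s) * c s)
      ≤ Fintype.card (Fin d → Bool) * Real.exp ((∑ s, c s ^ 2) / 2) := by
  have h1 := Finset.prod_univ_sum (fun _ : Fin d => (Finset.univ : Finset Bool))
    (fun s b => Real.exp (sgn b * c s))
  rw [Fintype.piFinset_univ] at h1
  simp only [Real.exp_sum]
  rw [← h1, Finset.sum_div, Real.exp_sum]
  have h2 : (Fintype.card (Fin d → Bool) : ℝ) = ∏ _s : Fin d, (2 : ℝ) := by simp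
  rw [h2, ← Finset.prod_mul_distrib]
  refine Finset.prod_le_prod (fun s _ => Finset.sum_nonneg fun b _ => (Real.exp_pos _).le)
    fun s _ => ?_
  have h3 := Real.cosh_le_exp_half_sq (c s)
  rw [Real.cosh_eq] at h3
  simp only [Fintype.sum_bool, sgn]
  simp only [if_true, one_mul, Bool.false_eq_true, if_false, neg_one_mul]
  linarith

open Classical in
theorem sum_lt_inner_signVec_le (hd : 0 < d) {R ρ : ℝ} (hR : 0 < R) (hρ : 0 ≤ ρ) {x : Euc d}
    (hx : ‖x‖ ≤ R) :
    ∑ e : Fin d → Bool, (if ρ < inner ℝ (signVec e) x then (1 : ℝ) else 0)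
      ≤ Fintype.card (Fin d → Bool) * Real.exp (-(ρ ^ 2 * d / (2 * R ^ 2))) := by
  have hd' : (0 : ℝ) < d := by exact_mod_cast hd
  -- This minimizes the Chernoff exponent t²R²/(2d) - tρ.
  set t : ℝ := ρ * d / R ^ 2 with ht
  have ht0 : 0 ≤ t := by positivity
  have h1 : ∀ e : Fin d → Bool, (if ρ < inner ℝ (signVec e) x then (1 : ℝ) else 0)
      ≤ Real.exp (-(t * ρ)) * Real.exp (∑ s, sgn (e s) * (t / √d * x s)) := by
    intro e
    have h2 : ∑ s, sgn (e s) * (t / √d * x s) = t * inner ℝ (signVec e) x := by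
      rw [inner_signVec, Finset.sum_div, Finset.mul_sum]
      exact Finset.sum_congr rfl fun s _ => by ring
    rw [h2, ← Real.exp_add]
    split_ifs with h
    · refine Real.one_le_exp ?_
      nlinarith
    · exact (Real.exp_pos _).le
  refine (Finset.sum_le_sum fun e _ => h1 e).trans ?_
  rw [← Finset.mul_sum]
  refine (mul_le_mul_of_nonneg_left (sum_exp_sgn_le _) (Real.exp_pos _).le).trans ?_
  rw [mul_left_comm, ← Real.exp_add]
  refine mul_le_mul_of_nonneg_left (Real.exp_le_exp.2 ?_) (Nat.cast_nonneg _)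
  have h3 : ∑ s, (t / √d * x s) ^ 2 = t ^ 2 / d * ‖x‖ ^ 2 := by
    rw [EuclideanSpace.norm_sq_eq, Finset.mul_sum]
    refine Finset.sum_congr rfl fun s _ => ?_
    rw [mul_pow, div_pow, Real.sq_sqrt hd'.le, Real.norm_eq_abs, sq_abs]
  rw [h3]
  have h4 : t ^ 2 / d * ‖x‖ ^ 2 ≤ t ^ 2 / d * R ^ 2 := by gcongr
  have h5 : t ^ 2 / d * R ^ 2 = ρ ^ 2 * d / R ^ 2 := by
    rw [ht]; field_simp
  have h6 : t * ρ = ρ ^ 2 * d / R ^ 2 := by rw [ht]; ring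
  have h7 : ρ ^ 2 * d / (2 * R ^ 2) = ρ ^ 2 * d / R ^ 2 / 2 := by field_simp
  linarith

open Classical in
/-- Hoeffding's inequality for a random sign vector. -/
theorem sum_lt_abs_inner_signVec_le (hd : 0 < d) {R ρ : ℝ} (hR : 0 < R) (hρ : 0 ≤ ρ) {x : Euc d}
    (hx : ‖x‖ ≤ R) :
    ∑ e : Fin d → Bool, (if ρ < |inner ℝ (signVec e) x| then (1 : ℝ) else 0)
      ≤ 2 * Real.exp (-(ρ ^ 2 * d / (2 * R ^ 2))) * Fintype.card (Fin d → Bool) := by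
  have h1 := sum_lt_inner_signVec_le hd hR hρ hx
  have h2 := sum_lt_inner_signVec_le hd hR hρ (x := -x) (by rwa [norm_neg])
  have h3 : ∑ e : Fin d → Bool, (if ρ < |inner ℝ (signVec e) x| then (1 : ℝ) else 0)
      ≤ ∑ e : Fin d → Bool, (if ρ < inner ℝ (signVec e) x then (1 : ℝ) else 0)
        + ∑ e : Fin d → Bool, (if ρ < inner ℝ (signVec e) (-x) then (1 : ℝ) else 0) := by
    rw [← Finset.sum_add_distrib]
    refine Finset.sum_le_sum fun e _ => ?_
    simp only [inner_neg_right, lt_abs]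
    split_ifs <;> simp_all
  linarith

end Signs

/-! ### Conditioning on a part of the hidden data -/

section Data

variable {N k : ℕ} {X : Type*}

/-- The first `j` hidden indices and the first `j` hidden vectors of `ω` and `ω'` agree. -/
def Agree (j : ℕ) (ω ω' : Equiv.Perm (Fin N) × (Fin k → X)) : Prop :=
  (∀ l : Fin N, l.val < j → ω.1 l = ω'.1 l) ∧ ∀ l : Fin k, l.val < j → ω.2 l = ω'.2 l

theorem Agree.mono {j : ℕ} {ω ω' : Equiv.Perm (Fin N) × (Fin k → X)} (h : Agree (j + 1) ω ω') :
    Agree j ω ω' :=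
  ⟨fun l hl => h.1 l (by omega), fun l hl => h.2 l (by omega)⟩

variable [Fintype X]

/-- Resampling a coordinate preserves the uniform law: exchanging the old value with the fresh one
is an involution on pairs. -/
theorem sum_sum_update {ι : Type*} [Fintype ι] [DecidableEq ι] (l : ι) (F : (ι → X) → ℝ) :
    ∑ e, ∑ y, F (Function.update e l y) = Fintype.card X * ∑ e, F e := by
  have hinv : Function.Involutive
      (fun a : (ι → X) × X => ((Function.update a.1 l a.2, a.1 l) : (ι → X) × X)) := by
    rintro ⟨e, y⟩
    simp
  rw [← Fintype.sum_prod_type' (f := fun e y => F (Function.update e l y)),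
    (Fintype.sum_equiv hinv.toPerm (fun a : (ι → X) × X => F (Function.update a.1 l a.2))
    (fun a => F a.1) fun a => rfl), Fintype.sum_prod_type, Finset.mul_sum]
  refine Finset.sum_congr rfl fun e _ => ?_
  simp

open Classical in
/-- An event is rare given `r` if it is rare under resampling of a coordinate which `r` ignores. -/
theorem RareGiven.of_update {P : Type*} [Fintype P] {ι : Type*} [Fintype ι] [DecidableEq ι]
    {r : P × (ι → X) → P × (ι → X) → Prop} {p : ℝ} {E : P × (ι → X) → Prop} (l : ι)
    (hr : ∀ σ e y, r (σ, e) (σ, Function.update e l y))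
    (hE : ∀ σ e, ∑ y, (if E (σ, Function.update e l y) then (1 : ℝ) else 0)
      ≤ p * Fintype.card X) : RareGiven r p E := by
  intro G hG hGr
  rw [Fintype.sum_prod_type, Fintype.sum_prod_type, Finset.mul_sum]
  refine Finset.sum_le_sum fun σ _ => ?_
  rcases isEmpty_or_nonempty X with hX | hX
  · have : IsEmpty (ι → X) := ⟨fun e => hX.elim (e l)⟩
    simp
  have hc : (0 : ℝ) < Fintype.card X := by exact_mod_cast Fintype.card_pos
  refine le_of_mul_le_mul_left ?_ hc
  rw [← sum_sum_update l (fun e => if E (σ, e) then G (σ, e) else 0), mul_left_comm,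
    Finset.mul_sum, Finset.mul_sum]
  refine Finset.sum_le_sum fun e _ => ?_
  calc ∑ y, (if E (σ, Function.update e l y) then G (σ, Function.update e l y) else 0)
      = (∑ y, (if E (σ, Function.update e l y) then (1 : ℝ) else 0)) * G (σ, e) := by
        rw [Finset.sum_mul]
        refine Finset.sum_congr rfl fun y _ => ?_
        rw [hGr _ _ (hr σ e y)]
        split_ifs <;> simp
    _ ≤ p * Fintype.card X * G (σ, e) := mul_le_mul_of_nonneg_right (hE σ e) (hG _)
    _ = _ := by ring

/-- A new hidden index is uniformly distributed among those not used before. -/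
theorem rareGiven_index {j : ℕ} (hj : j < N) (i : Fin N) :
    RareGiven (Agree (N := N) (k := k) (X := X) j) (1 / (N - j : ℝ))
      (fun ω => ω.1 ⟨j, hj⟩ = i) := by
  classical
  intro G hG hGr
  have hNj : (0 : ℝ) < N - j := by
    have : (j : ℝ) < N := by exact_mod_cast hj
    linarith
  -- Swapping the positions `l` and `j`, neither of which is known yet, leaves `G` unchanged. So the
  -- `N - j` positions are equally likely to carry `i`, and these events are disjoint.
  have key : ∀ l ∈ Finset.Ici (⟨j, hj⟩ : Fin N),
      ∑ ω, (if ω.1 l = i then G ω else 0) = ∑ ω, (if ω.1 ⟨j, hj⟩ = i then G ω else 0) := by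
    intro l hl
    have hl' : j ≤ l.val := Fin.le_def.1 (Finset.mem_Ici.1 hl)
    refine Fintype.sum_equiv ((Equiv.mulRight (Equiv.swap l ⟨j, hj⟩)).prodCongr (Equiv.refl _)) _ _
      fun ω => ?_
    have h1 : G ω = G ((Equiv.mulRight (Equiv.swap l ⟨j, hj⟩)).prodCongr (Equiv.refl _) ω) := by
      refine hGr _ _ ⟨fun l' hl' => ?_, fun _ _ => rfl⟩
      have : Equiv.swap l ⟨j, hj⟩ l' = l' :=
        Equiv.swap_apply_of_ne_of_ne (by rintro rfl; omega) (by rintro rfl; simp at hl')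
      simp [this]
    rw [← h1]
    simp
  have h2 : ∑ l ∈ Finset.Ici (⟨j, hj⟩ : Fin N), ∑ ω, (if ω.1 l = i then G ω else 0) ≤ ∑ ω, G ω := by
    rw [Finset.sum_comm]
    refine Finset.sum_le_sum fun ω _ => ?_
    calc ∑ l ∈ Finset.Ici (⟨j, hj⟩ : Fin N), (if ω.1 l = i then G ω else 0)
        ≤ ∑ l, (if ω.1 l = i then G ω else 0) :=
          Finset.sum_le_sum_of_subset_of_nonneg (Finset.subset_univ _)
            fun l _ _ => by split_ifs <;> simp [hG]
      _ = G ω := by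
          simp only [← Equiv.eq_symm_apply, Finset.sum_ite_eq', Finset.mem_univ, if_true]
  rw [Finset.sum_congr rfl key, Finset.sum_const, Fin.card_Ici, nsmul_eq_mul] at h2
  rw [one_div_mul_eq_div, le_div_iff₀ hNj, mul_comm]
  refine le_trans (le_of_eq ?_) h2
  rw [Nat.cast_sub hj.le]
  congr! 4

end Data

/-! ### The random chain -/

section Chain

variable {N d k : ℕ}

/-- The hidden data: a permutation whose first values are the hidden indices, and the signs of the
entries of the hidden vectors. -/
abbrev Hidden (N k d : ℕ) : Type := Equiv.Perm (Fin N) × (Fin k → Fin d → Bool)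

/-- The values `h, ⟨v₀, x⟩, ⟨v₁, x⟩, …` which the links of the chain compare. -/
def potential (h : ℝ) (e : Fin k → Fin d → Bool) (x : Euc d) : ℕ → ℝ
  | 0 => h
  | l + 1 => if hl : l < k then inner ℝ (signVec (e ⟨l, hl⟩)) x else 0

open Classical in
/-- The `i`-th function built from the first `j` links, where link `l` belongs to the `i`-th
function if `mask σ l i`. -/
def chainFun (mask : Equiv.Perm (Fin N) → ℕ → Fin N → Prop) (φ : ℝ → ℝ) (h : ℝ) (j : ℕ)
    (ω : Hidden N k d) (i : Fin N) (x : Euc d) : ℝ :=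
  ∑ l ∈ Finset.range j,
    if mask ω.1 l i then φ (potential h ω.2 x l - potential h ω.2 x (l + 1)) else 0

/-- The conditional probability that `x` is correlated with one of the vectors not yet known. -/
def escapeProb (k d : ℕ) (R ρ : ℝ) : ℝ := k * (2 * Real.exp (-(ρ ^ 2 * d / (2 * R ^ 2))))

theorem escapeProb_nonneg (k d : ℕ) (R ρ : ℝ) : 0 ≤ escapeProb k d R ρ := by
  unfold escapeProb; positivity

theorem rareGiven_exists_lt_abs_inner (hd : 0 < d) {R ρ : ℝ} (hR : 0 < R) (hρ : 0 ≤ ρ) {x : Euc d}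
    (hx : ‖x‖ ≤ R) (j : ℕ) :
    RareGiven (Agree (N := N) (k := k) j) (escapeProb k d R ρ)
      (fun ω => ∃ l : Fin k, j ≤ l.val ∧ ρ < |inner ℝ (signVec (ω.2 l)) x|) := by
  classical
  have h1 := RareGiven.exists_mem (r := Agree (N := N) (k := k) (X := Fin d → Bool) j)
    (p := 2 * Real.exp (-(ρ ^ 2 * d / (2 * R ^ 2))))
    (Finset.univ.filter fun l : Fin k => j ≤ l.val)
    (E := fun l ω => ρ < |inner ℝ (signVec (ω.2 l)) x|) fun l hl => by
      refine RareGiven.of_update (E := fun ω : Hidden N k d => ρ < |inner ℝ (signVec (ω.2 l)) x|) l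
        (fun σ e y => ⟨fun _ _ => rfl, fun l' hl' => ?_⟩) fun σ e => ?_
      · have hne : l' ≠ l := by
          rintro rfl
          simp at hl
          omega
        simp [hne]
      · simp only [Function.update_self]
        convert sum_lt_abs_inner_signVec_le hd hR hρ hx
  refine h1.mono ?_ fun ω ⟨l, hl, hlt⟩ => ⟨l, by simp [hl], hlt⟩
  refine mul_le_mul_of_nonneg_right ?_ (by positivity)
  exact_mod_cast (Finset.card_filter_le _ _).trans (by simp)

/-- A link l ≥ j compares two correlations of size at most `ρ` and so lies in the dead zone. The
exception is link 0, which starts from `h`; hence `j ≠ 0`. With `k = 1` no dead zone is needed,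
which admits the linear instance. -/
theorem chainFun_eq {mask : Equiv.Perm (Fin N) → ℕ → Fin N → Prop} {φ : ℝ → ℝ} {h ρ : ℝ}
    (hφ : 1 < k → ∀ s ≤ 2 * ρ, φ s = 0) {j n : ℕ} (hjn : j ≤ n) (hnk : n ≤ k) (ω : Hidden N k d)
    (i : Fin N) (x : Euc d)
    (hfar : ∀ l : Fin k, j ≤ l.val + 1 → |inner ℝ (signVec (ω.2 l)) x| ≤ ρ) (hj : j ≠ 0) :
    chainFun mask φ h n ω i x = chainFun mask φ h j ω i x := by
  classical
  rw [chainFun, chainFun, ← Finset.sum_range_add_sum_Ico _ hjn, add_eq_left]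
  refine Finset.sum_eq_zero fun l hl => ?_
  rw [Finset.mem_Ico] at hl
  obtain ⟨l, rfl⟩ : ∃ l', l = l' + 1 := ⟨l - 1, by omega⟩
  have h1 := hfar ⟨l, by omega⟩ (by simp; omega)
  have h2 := hfar ⟨l + 1, by omega⟩ (by simp; omega)
  have h3 : φ (potential h ω.2 x (l + 1) - potential h ω.2 x (l + 1 + 1)) = 0 := by
    refine hφ (by omega) _ ?_
    rw [potential, potential, dif_pos (by omega), dif_pos (by omega)]
    rw [abs_le] at h1 h2
    linarith
  simp [h3]

theorem chainFun_congr {mask : Equiv.Perm (Fin N) → ℕ → Fin N → Prop}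
    (hmask : ∀ l σ σ' i, (∀ m : Fin N, m.val ≤ l → σ m = σ' m) → (mask σ l i ↔ mask σ' l i))
    (φ : ℝ → ℝ) (h : ℝ) {j : ℕ} {ω ω' : Hidden N k d} (hr : Agree j ω ω') :
    chainFun mask φ h j ω = chainFun mask φ h j ω' := by
  classical
  have hpot : ∀ x l, l ≤ j → potential h ω.2 x l = potential h ω'.2 x l := by
    intro x l hl
    cases l with
    | zero => rfl
    | succ l =>
      rw [potential, potential]
      split_ifs with hlk
      · rw [hr.2 ⟨l, hlk⟩ hl]
      · rfl
  ext i x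
  refine Finset.sum_congr rfl fun l hl => ?_
  rw [Finset.mem_range] at hl
  rw [hpot x l hl.le, hpot x (l + 1) hl]
  simp only [hmask l ω.1 ω'.1 i fun m hm => hr.1 m (by omega)]

theorem isHiddenChain_chainFun (hd : 0 < d) {R ρ : ℝ} (hR : 0 < R) (hρ : 0 ≤ ρ)
    {mask : Equiv.Perm (Fin N) → ℕ → Fin N → Prop}
    (hmask : ∀ l σ σ' i, (∀ m : Fin N, m.val ≤ l → σ m = σ' m) → (mask σ l i ↔ mask σ' l i))
    {p : ℝ} (hp : 0 ≤ p)
    (hmaskp : ∀ j < k, ∀ i, RareGiven (Agree (N := N) (k := k) (X := Fin d → Bool) j) p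
      (fun ω => mask ω.1 j i))
    {φ : ℝ → ℝ} (hφ : 1 < k → ∀ s ≤ 2 * ρ, φ s = 0) (h : ℝ) :
    IsHiddenChain R k (Agree (N := N) (k := k) (X := Fin d → Bool)) (chainFun mask φ h)
      (p + escapeProb k d R ρ) (escapeProb k d R ρ) where
  mono j ω ω' hr := hr.mono
  resp j ω ω' hr := chainFun_congr hmask φ h hr
  next j n hjn hnk i x := by
    have hx : ‖(x : Euc d)‖ ≤ R := mem_closedBall_zero_iff.1 x.2
    rcases hjn.eq_or_lt with rfl | hlt
    · exact (RareGiven.false _ (by simp)).mono (add_nonneg hp (escapeProb_nonneg _ _ _ _))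
        fun ω hω => hω
    -- If `x` is uncorrelated with the unknown vectors, only link `j` can make a difference, and
    -- then only if the mask assigns it to `i`.
    · refine ((hmaskp j (by omega) i).or (rareGiven_exists_lt_abs_inner hd hR hρ hx j)).mono le_rfl
        fun ω hω => ?_
      by_contra hc
      push Not at hc
      apply hω
      rw [chainFun_eq hφ (j := j + 1) hlt hnk ω i x (fun l hl => hc.2 l (by omega)) (by omega),
        chainFun, Finset.sum_range_succ]
      simp [hc.1, chainFun]
  far j n hjn hnk i x := by
    have hx : ‖(x : Euc d)‖ ≤ R := mem_closedBall_zero_iff.1 x.2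
    refine (rareGiven_exists_lt_abs_inner hd hR hρ hx j).mono le_rfl fun ω hω => ?_
    by_contra hc
    push Not at hc
    exact hω (chainFun_eq hφ hjn hnk ω i x (fun l hl => hc l (by omega)) (by omega))

/-- Most choices of the signs give nearly orthogonal vectors. -/
theorem rareGiven_not_nearly_orthogonal (hd : 0 < d) {γ : ℝ} (hγ : 0 ≤ γ) :
    RareGiven (fun _ _ : Hidden N k d => True) (k ^ 2 * (2 * Real.exp (-(γ ^ 2 * d / 2))))
      (fun ω => ∃ a b : Fin k, a ≠ b ∧
        γ < |inner ℝ (signVec (ω.2 a)) (signVec (ω.2 b))|) := by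
  classical
  have h1 := RareGiven.exists_mem (r := fun _ _ : Hidden N k d => True)
    (p := 2 * Real.exp (-(γ ^ 2 * d / 2)))
    (Finset.univ.filter fun a : Fin k × Fin k => a.1 ≠ a.2)
    (E := fun a ω => γ < |inner ℝ (signVec (ω.2 a.1)) (signVec (ω.2 a.2))|) fun a ha => by
      refine RareGiven.of_update (E := fun ω : Hidden N k d =>
        γ < |inner ℝ (signVec (ω.2 a.1)) (signVec (ω.2 a.2))|) a.1 (fun _ _ _ => trivial)
        fun σ e => ?_
      have hne : a.2 ≠ a.1 := fun h => by simp [h] at ha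
      simp only [Function.update_self, Function.update_of_ne hne]
      have := sum_lt_abs_inner_signVec_le hd one_pos hγ (norm_signVec hd (e a.2)).le
      simpa using this
  have hcard : ((Finset.univ.filter fun a : Fin k × Fin k => a.1 ≠ a.2).card : ℝ) ≤ k ^ 2 := by
    exact_mod_cast (Finset.card_filter_le _ _).trans (by simp [sq])
  exact h1.mono (mul_le_mul_of_nonneg_right hcard (by positivity))
    fun ω ⟨a, b, hab, hlt⟩ => ⟨(a, b), by simp [hab], hlt⟩

end Chain

/-! ### Link functions -/

/-- `φ` is a nondecreasing convex function with derivative `φ'`, slope at most `b` and second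
derivative at most `a`. -/
structure IsLink (a b : ℝ) (φ φ' : ℝ → ℝ) : Prop where
  hasDerivAt : ∀ s, HasDerivAt φ (φ' s) s
  mono : Monotone φ'
  nonneg : ∀ s, 0 ≤ φ' s
  le : ∀ s, φ' s ≤ b
  lipschitz : ∀ s t, |φ' s - φ' t| ≤ a * |s - t|

namespace IsLink

variable {a b : ℝ} {φ φ' : ℝ → ℝ}

theorem convexOn (h : IsLink a b φ φ') : ConvexOn ℝ Set.univ φ := by
  have hd : deriv φ = φ' := funext fun s => (h.hasDerivAt s).deriv
  exact Monotone.convexOn_univ_of_deriv (fun s => (h.hasDerivAt s).differentiableAt) (hd ▸ h.mono)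

theorem monotone (h : IsLink a b φ φ') : Monotone φ :=
  monotone_of_deriv_nonneg (fun s => (h.hasDerivAt s).differentiableAt)
    fun s => (h.hasDerivAt s).deriv ▸ h.nonneg s

theorem abs_sub_le (h : IsLink a b φ φ') (s t : ℝ) : |φ s - φ t| ≤ b * |s - t| := by
  have := Convex.norm_image_sub_le_of_norm_hasDerivWithin_le (f := φ) (f' := φ') (C := b)
    (fun x _ => (h.hasDerivAt x).hasDerivWithinAt)
    (fun x _ => by rw [Real.norm_eq_abs, abs_of_nonneg (h.nonneg x)]; exact h.le x)
    convex_univ (Set.mem_univ t) (Set.mem_univ s)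
  simpa using this

theorem comp_sub_const (h : IsLink a b φ φ') (t : ℝ) :
    IsLink a b (fun s => φ (s - t)) (fun s => φ' (s - t)) where
  hasDerivAt s := by simpa using (h.hasDerivAt (s - t)).comp_sub_const s t
  mono s s' hs := h.mono (by linarith)
  nonneg s := h.nonneg _
  le s := h.le _
  lipschitz s s' := by simpa using h.lipschitz (s - t) (s' - t)

theorem linear (ha : 0 ≤ a) (hb : 0 ≤ b) : IsLink a b (fun s => b * s) (fun _ => b) where
  hasDerivAt s := by simpa using (hasDerivAt_id s).const_mul b
  mono := monotone_const
  nonneg _ := hb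
  le _ := le_rfl
  lipschitz s t := by simp; positivity

end IsLink

theorem hasDerivAt_max_zero_sq (s : ℝ) : HasDerivAt (fun s : ℝ => max s 0 ^ 2) (2 * max s 0) s := by
  rcases lt_trichotomy s 0 with hs | rfl | hs
  · rw [max_eq_right hs.le, mul_zero]
    refine (hasDerivAt_const s (0 : ℝ)).congr_of_eventuallyEq ?_
    filter_upwards [gt_mem_nhds hs] with t ht
    simp [max_eq_right ht.le]
  · rw [hasDerivAt_iff_isLittleO_nhds_zero]
    simp only [zero_add, max_self, mul_zero, smul_zero, sub_zero, ne_eq, OfNat.ofNat_ne_zero,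
      not_false_eq_true, zero_pow]
    refine Asymptotics.IsBigO.trans_isLittleO (g := fun t : ℝ => t ^ 2) ?_
      (Asymptotics.isLittleO_pow_id one_lt_two)
    refine Asymptotics.IsBigO.of_bound 1 (Filter.Eventually.of_forall fun t => ?_)
    rw [one_mul, norm_pow, norm_pow]
    refine pow_le_pow_left₀ (norm_nonneg _) ?_ 2
    simp only [Real.norm_eq_abs]
    rcases le_total t 0 with h | h <;> simp [h]
  · rw [max_eq_left hs.le]
    refine HasDerivAt.congr_of_eventuallyEq (f := fun t : ℝ => t ^ 2) ?_ ?_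
    · simpa using hasDerivAt_pow 2 s
    · filter_upwards [lt_mem_nhds hs] with t ht
      rw [max_eq_left ht.le]

/-- The one-sided Huber function: `a s² / 2` for small positive `s`, with slope at most `b`. -/
def huber (a b s : ℝ) : ℝ := a / 2 * max s 0 ^ 2 - a / 2 * max (s - b / a) 0 ^ 2

theorem isLink_huber {a b : ℝ} (ha : 0 < a) (hb : 0 < b) :
    IsLink a b (huber a b) (fun s => min (a * max s 0) b) := by
  refine ⟨fun s => ?_, fun s t hst => ?_, fun s => ?_, fun s => min_le_right _ _, fun s t => ?_⟩
  · have h1 := (hasDerivAt_max_zero_sq s).const_mul (a / 2)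
    have h2 := ((hasDerivAt_max_zero_sq (s - b / a)).comp_sub_const s (b / a)).const_mul (a / 2)
    refine (h1.sub h2).congr_deriv ?_
    have hba : 0 < b / a := by positivity
    have hab : a * (b / a) = b := by field_simp
    rcases le_total s (b / a) with h | h
    · have h3 : max s 0 ≤ b / a := max_le h hba.le
      rw [max_eq_right (a := s - b / a) (by linarith), min_eq_left (by nlinarith)]
      ring
    · rw [max_eq_left (a := s - b / a) (by linarith), max_eq_left (a := s) (by linarith),
        min_eq_right (by nlinarith)]
      linear_combination hab
  · have : max s 0 ≤ max t 0 := max_le_max_right 0 hst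
    exact min_le_min_right b (by gcongr)
  · exact le_min (by positivity) hb.le
  · refine (abs_min_sub_min_le_max _ _ _ _).trans (max_le ?_ ?_)
    · rw [← mul_sub, abs_mul, abs_of_pos ha]
      have h := abs_max_sub_max_le_max s 0 t 0
      rw [sub_self, abs_zero, max_eq_left (abs_nonneg (s - t))] at h
      exact mul_le_mul_of_nonneg_left h ha.le
    · simp; positivity

theorem huber_eq_zero {a b s : ℝ} (ha : 0 < a) (hb : 0 < b) (hs : s ≤ 0) : huber a b s = 0 := by
  have hba : 0 < b / a := by positivity
  rw [huber, max_eq_right hs, max_eq_right (by linarith)]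
  simp

theorem huber_nonneg {a b : ℝ} (ha : 0 < a) (hb : 0 < b) (s : ℝ) : 0 ≤ huber a b s := by
  rcases le_total s 0 with hs | hs
  · rw [huber_eq_zero ha hb hs]
  · rw [← huber_eq_zero ha hb le_rfl]
    exact (isLink_huber ha hb).monotone hs

theorem le_huber {a b s : ℝ} (ha : 0 < a) (hb : 0 < b) (hs : 0 ≤ s) :
    min (a * s ^ 2) (b * s) / 2 ≤ huber a b s := by
  have hab : a * (b / a) = b := by field_simp
  rw [huber, max_eq_left hs]
  rcases le_total s (b / a) with h | h
  · rw [max_eq_right (by linarith)]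
    have := min_le_left (a * s ^ 2) (b * s)
    nlinarith
  · rw [max_eq_left (by linarith)]
    have := min_le_right (a * s ^ 2) (b * s)
    have h2 : b * (b / a) ≤ b * s := by gcongr
    have h3 : a / 2 * s ^ 2 - a / 2 * (s - b / a) ^ 2 = b * s - b * (b / a) / 2 := by
      linear_combination (s - (b / a) / 2) * hab
    linarith

/-! ### Sums of link functions -/

section Sums

variable {d : ℕ}

/-- A Bessel inequality by duality: the synthesis map y ↦ ∑ y_l z_l and its adjoint have the same
norm. -/
theorem sum_inner_sq_le {ι : Type*} {Λ : ℝ} (hΛ : 0 ≤ Λ) (t : Finset ι) {z : ι → Euc d}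
    (hz : ∀ y : ι → ℝ, ‖∑ l ∈ t, y l • z l‖ ^ 2 ≤ Λ * ∑ l ∈ t, y l ^ 2) (x : Euc d) :
    ∑ l ∈ t, inner ℝ (z l) x ^ 2 ≤ Λ * ‖x‖ ^ 2 := by
  set Q := ∑ l ∈ t, inner ℝ (z l) x ^ 2 with hQ
  have hQ0 : 0 ≤ Q := Finset.sum_nonneg fun l _ => sq_nonneg _
  have h1 : Q = inner ℝ (∑ l ∈ t, (inner ℝ (z l) x : ℝ) • z l) x := by
    rw [sum_inner]
    exact Finset.sum_congr rfl fun l _ => by rw [real_inner_smul_left, sq]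
  have h2 := hz fun l => inner ℝ (z l) x
  have h3 := abs_real_inner_le_norm (∑ l ∈ t, (inner ℝ (z l) x : ℝ) • z l) x
  rw [← h1, abs_of_nonneg hQ0] at h3
  have h4 : Q * Q ≤ Λ * ‖x‖ ^ 2 * Q := by
    calc Q * Q ≤ _ := mul_le_mul h3 h3 hQ0 (by positivity)
      _ = ‖∑ l ∈ t, (inner ℝ (z l) x : ℝ) • z l‖ ^ 2 * ‖x‖ ^ 2 := by ring
      _ ≤ Λ * Q * ‖x‖ ^ 2 := by gcongr
      _ = _ := by ring
  rcases hQ0.eq_or_lt with h0 | h0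
  · rw [← h0]; positivity
  · exact le_of_mul_le_mul_right h4 h0

variable {ι : Type*} {a b Λ : ℝ} {φ φ' : ℝ → ℝ}

theorem hasGradientAt_sum (t : Finset ι) (z : ι → Euc d) (c : ι → ℝ) (h : IsLink a b φ φ')
    (x : Euc d) : HasGradientAt (fun x => ∑ l ∈ t, φ (c l + inner ℝ (z l) x))
      (∑ l ∈ t, φ' (c l + inner ℝ (z l) x) • z l) x := by
  rw [hasGradientAt_iff_hasFDerivAt]
  have h1 : ∀ l ∈ t, HasFDerivAt (fun x => φ (c l + inner ℝ (z l) x))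
      (φ' (c l + inner ℝ (z l) x) • innerSL ℝ (z l)) x := fun l _ =>
    (h.hasDerivAt _).comp_hasFDerivAt x (((innerSL ℝ (z l)).hasFDerivAt).const_add (c l))
  refine (HasFDerivAt.fun_sum h1).congr_fderiv ?_
  ext y
  simp

/-- A sum of link functions of near-orthogonal directions is admissible. -/
theorem isAdmissible_sum {t : Finset ι} {z : ι → Euc d} (c : ι → ℝ) (hΛ : 0 ≤ Λ)
    (hz : ∀ y : ι → ℝ, ‖∑ l ∈ t, y l • z l‖ ^ 2 ≤ Λ * ∑ l ∈ t, y l ^ 2) (h : IsLink a b φ φ')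
    {Lf Lg : ℝ} (ha : 0 ≤ a) (hb : 0 ≤ b)
    (hLf0 : 0 ≤ Lf) (hLf : t.card * Λ * b ^ 2 ≤ Lf ^ 2)
    (hLg : Λ * a ≤ Lg) :
    IsAdmissible Lf Lg (fun x : Euc d => ∑ l ∈ t, φ (c l + inner ℝ (z l) x)) where
  convex := by
    refine ⟨convex_univ, fun x _ y _ α β hα hβ hαβ => ?_⟩
    simp only [smul_eq_mul]
    rw [Finset.mul_sum, Finset.mul_sum, ← Finset.sum_add_distrib]
    refine Finset.sum_le_sum fun l _ => ?_
    have h1 := h.convexOn.2 (Set.mem_univ (c l + inner ℝ (z l) x))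
      (Set.mem_univ (c l + inner ℝ (z l) y)) hα hβ hαβ
    simp only [smul_eq_mul] at h1
    refine le_trans (le_of_eq ?_) h1
    congr 1
    rw [inner_add_right, real_inner_smul_right, real_inner_smul_right]
    linear_combination (-c l) * hαβ
  lipschitz x y := by
    rw [← Finset.sum_sub_distrib]
    have h1 : |∑ l ∈ t, (φ (c l + inner ℝ (z l) x) - φ (c l + inner ℝ (z l) y))|
        ≤ b * ∑ l ∈ t, |inner ℝ (z l) (x - y)| := by
      rw [Finset.mul_sum]
      refine (Finset.abs_sum_le_sum_abs _ _).trans (Finset.sum_le_sum fun l _ => ?_)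
      refine (h.abs_sub_le _ _).trans (le_of_eq ?_)
      rw [inner_sub_right]
      congr 2
      ring
    refine h1.trans (le_of_sq_le_sq ?_ (by positivity))
    have h2 := sq_sum_le_card_mul_sum_sq (s := t) (f := fun l => |inner ℝ (z l) (x - y)|)
    simp only [sq_abs] at h2
    have h3 := sum_inner_sq_le hΛ t hz (x - y)
    calc (b * ∑ l ∈ t, |inner ℝ (z l) (x - y)|) ^ 2
        = b ^ 2 * (∑ l ∈ t, |inner ℝ (z l) (x - y)|) ^ 2 := by ring
      _ ≤ b ^ 2 * (t.card * (Λ * ‖x - y‖ ^ 2)) := by gcongr; exact h2.trans (by gcongr)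
      _ = t.card * Λ * b ^ 2 * ‖x - y‖ ^ 2 := by ring
      _ ≤ Lf ^ 2 * ‖x - y‖ ^ 2 := by gcongr
      _ = _ := by ring
  differentiable x := (hasGradientAt_sum t z c h x).differentiableAt
  smooth x y := by
    rw [(hasGradientAt_sum t z c h x).gradient, (hasGradientAt_sum t z c h y).gradient,
      ← Finset.sum_sub_distrib]
    simp only [← sub_smul]
    -- The gradient difference is the synthesis map applied to the slope differences. Synthesis and
    -- its adjoint each cost √Λ, and the slopes cost `a`.
    have h1 := hz fun l => φ' (c l + inner ℝ (z l) x) - φ' (c l + inner ℝ (z l) y)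
    have h2 := sum_inner_sq_le hΛ t hz (x - y)
    have h3 : ∑ l ∈ t, (φ' (c l + inner ℝ (z l) x) - φ' (c l + inner ℝ (z l) y)) ^ 2
        ≤ a ^ 2 * ∑ l ∈ t, inner ℝ (z l) (x - y) ^ 2 := by
      rw [Finset.mul_sum]
      refine Finset.sum_le_sum fun l _ => ?_
      have := h.lipschitz (c l + inner ℝ (z l) x) (c l + inner ℝ (z l) y)
      rw [add_sub_add_left_eq_sub, ← inner_sub_right] at this
      rw [← sq_abs, ← sq_abs (inner ℝ (z l) (x - y)), ← mul_pow]
      gcongr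
    refine le_trans (le_of_sq_le_sq ?_ (by positivity) : _ ≤ Λ * a * ‖x - y‖) (by gcongr)
    calc _ ≤ _ := h1
      _ ≤ Λ * (a ^ 2 * (Λ * ‖x - y‖ ^ 2)) := by gcongr; exact h3.trans (by gcongr)
      _ = _ := by ring

end Sums

/-! ### Nearly orthonormal vectors -/

section NearlyOrthonormal

variable {d : ℕ} {ι : Type*}

/-- The off-diagonal part of the Gram form is at most γ(∑|c_l|)², which Cauchy–Schwarz compares with
∑c_l². -/
theorem abs_norm_sum_smul_sq_sub_le {t : Finset ι} {v : ι → Euc d} {γ : ℝ}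
    (hv : ∀ l ∈ t, ‖v l‖ = 1)
    (hγ : ∀ l ∈ t, ∀ m ∈ t, l ≠ m → |inner ℝ (v l) (v m)| ≤ γ) (hγ0 : 0 ≤ γ)
    (ht : t.card * γ ≤ 1 / 2) (c : ι → ℝ) :
    |‖∑ l ∈ t, c l • v l‖ ^ 2 - ∑ l ∈ t, c l ^ 2| ≤ 1 / 2 * ∑ l ∈ t, c l ^ 2 := by
  classical
  have h1 : ‖∑ l ∈ t, c l • v l‖ ^ 2 = ∑ l ∈ t, ∑ m ∈ t, c l * c m * inner ℝ (v l) (v m) := by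
    rw [← real_inner_self_eq_norm_sq, sum_inner]
    refine Finset.sum_congr rfl fun l _ => ?_
    rw [inner_sum]
    refine Finset.sum_congr rfl fun m _ => ?_
    rw [real_inner_smul_left, real_inner_smul_right]
    ring
  have h2 : ∑ l ∈ t, c l ^ 2 = ∑ l ∈ t, ∑ m ∈ t, if m = l then c l * c m else 0 := by
    refine Finset.sum_congr rfl fun l hl => ?_
    rw [Finset.sum_ite_eq' t l, if_pos hl, sq]
  have h3 : |‖∑ l ∈ t, c l • v l‖ ^ 2 - ∑ l ∈ t, c l ^ 2|
      ≤ ∑ l ∈ t, ∑ m ∈ t, |c l| * |c m| * γ := by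
    rw [h1, h2, ← Finset.sum_sub_distrib]
    refine (Finset.abs_sum_le_sum_abs _ _).trans (Finset.sum_le_sum fun l hl => ?_)
    rw [← Finset.sum_sub_distrib]
    refine (Finset.abs_sum_le_sum_abs _ _).trans (Finset.sum_le_sum fun m hm => ?_)
    by_cases hml : m = l
    · subst hml
      rw [if_pos rfl, real_inner_self_eq_norm_sq, hv m hm]
      simp only [one_pow, mul_one, sub_self, abs_zero]
      positivity
    · rw [if_neg hml, sub_zero, abs_mul, abs_mul]
      exact mul_le_mul_of_nonneg_left (hγ l hl m hm (Ne.symm hml)) (by positivity)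
  have h4 : ∑ l ∈ t, ∑ m ∈ t, |c l| * |c m| * γ = γ * (∑ l ∈ t, |c l|) ^ 2 := by
    rw [sq, Finset.sum_mul_sum, Finset.mul_sum]
    refine Finset.sum_congr rfl fun l _ => ?_
    rw [Finset.mul_sum]
    exact Finset.sum_congr rfl fun m _ => by ring
  have h5 := sq_sum_le_card_mul_sum_sq (s := t) (f := fun l => |c l|)
  simp only [sq_abs] at h5
  have h6 : 0 ≤ ∑ l ∈ t, c l ^ 2 := Finset.sum_nonneg fun l _ => sq_nonneg _
  rw [h4] at h3
  calc _ ≤ _ := h3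
    _ ≤ γ * (t.card * ∑ l ∈ t, c l ^ 2) := by gcongr
    _ = t.card * γ * ∑ l ∈ t, c l ^ 2 := by ring
    _ ≤ _ := by gcongr

/-- Nearly orthonormal vectors have a short common correlate. -/
theorem exists_inner_eq {k : ℕ} (hk : 0 < k) {v : Fin k → Euc d} (hv : ∀ l, ‖v l‖ = 1)
    (hγ : ∀ l m, l ≠ m → |inner ℝ (v l) (v m)| ≤ 1 / (2 * k)) (h : ℝ) :
    ∃ x : Euc d, (∀ l, inner ℝ (v l) x = h) ∧ ‖x‖ ^ 2 ≤ 2 * k * h ^ 2 := by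
  have hk' : (0 : ℝ) < k := by exact_mod_cast hk
  have hbound : ∀ a : Fin k → ℝ, 1 / 2 * ∑ l, a l ^ 2 ≤ ‖∑ l, a l • v l‖ ^ 2 := fun a => by
    have := abs_norm_sum_smul_sq_sub_le (t := Finset.univ) (fun l _ => hv l)
      (fun l _ m _ => hγ l m) (by positivity) (by simp; field_simp; norm_num) a
    linarith [(abs_le.1 this).1]
  let Φ : (Fin k → ℝ) →ₗ[ℝ] (Fin k → ℝ) :=
    { toFun := fun a l => inner ℝ (v l) (∑ m, a m • v m)
      map_add' := fun a b => by
        ext l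
        simp [add_smul, Finset.sum_add_distrib, inner_add_right]
      map_smul' := fun c a => by
        ext l
        simp [mul_smul, ← Finset.smul_sum, real_inner_smul_right] }
  have hnorm : ∀ a, ‖∑ l, a l • v l‖ ^ 2 = ∑ l, a l * Φ a l := fun a => by
    rw [← real_inner_self_eq_norm_sq, sum_inner]
    exact Finset.sum_congr rfl fun l _ => by rw [real_inner_smul_left]; rfl
  -- `Φ` is the Gram matrix; coercivity makes it injective, hence surjective, and the point sought
  -- is found in the span of the vectors.
  have hinj : Function.Injective Φ := by
    rw [injective_iff_map_eq_zero]
    intro a ha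
    have h1 := hbound a
    rw [hnorm a, ha] at h1
    simp only [Pi.zero_apply, mul_zero, Finset.sum_const_zero] at h1
    have h2 : ∑ l, a l ^ 2 = 0 :=
      le_antisymm (by linarith) (Finset.sum_nonneg fun l _ => sq_nonneg _)
    ext l
    have := (Finset.sum_eq_zero_iff_of_nonneg fun l _ => sq_nonneg (a l)).1 h2 l (Finset.mem_univ l)
    simpa using this
  obtain ⟨a, ha⟩ := (LinearMap.injective_iff_surjective.1 hinj) fun _ => h
  refine ⟨∑ l, a l • v l, fun l => congrFun ha l, ?_⟩
  have h1 := hbound a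
  have h2 := hnorm a
  simp only [ha, ← Finset.sum_mul] at h2
  have h3 := sq_sum_le_card_mul_sum_sq (s := Finset.univ) (f := a)
  rw [Finset.card_univ, Fintype.card_fin] at h3
  set A := ∑ l, a l
  set Q := ∑ l, a l ^ 2
  rw [h2] at h1 ⊢
  -- Here ‖x‖² = A h. Cauchy–Schwarz gives A² ≤ kQ, and coercivity gives Q ≤ 2Ah.
  have h4 : A ^ 2 ≤ 2 * k * (A * h) := by nlinarith
  rcases le_or_gt (A * h) 0 with hA | hA
  · exact hA.trans (by positivity)
  · have h5 : (A * h) * (A * h) ≤ 2 * k * h ^ 2 * (A * h) := by nlinarith [sq_nonneg h]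
    exact le_of_mul_le_mul_right h5 hA

end NearlyOrthonormal

/-! ### The objective built from the chain -/

section Objective

variable {N d k : ℕ}

/-- The hidden vectors, preceded by `0` and padded by `0`. -/
def hiddenVec (e : Fin k → Fin d → Bool) : ℕ → Euc d
  | 0 => 0
  | l + 1 => if hl : l < k then signVec (e ⟨l, hl⟩) else 0

theorem potential_eq (h : ℝ) (e : Fin k → Fin d → Bool) (x : Euc d) (l : ℕ) :
    potential h e x l = (if l = 0 then h else 0) + inner ℝ (hiddenVec e l) x := by
  cases l with
  | zero => simp [potential, hiddenVec]
  | succ l =>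
    simp only [potential, hiddenVec]
    split_ifs <;> simp_all

open Classical in
theorem chainFun_eq_sum (mask : Equiv.Perm (Fin N) → ℕ → Fin N → Prop) (φ : ℝ → ℝ) (h : ℝ) (j : ℕ)
    (ω : Hidden N k d) (i : Fin N) :
    chainFun mask φ h j ω i = fun x => ∑ l ∈ (Finset.range j).filter (fun l => mask ω.1 l i),
      φ ((if l = 0 then h else 0) + inner ℝ (hiddenVec ω.2 l - hiddenVec ω.2 (l + 1)) x) := by
  ext x
  rw [chainFun, Finset.sum_filter]
  refine Finset.sum_congr rfl fun l _ => ?_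
  rw [potential_eq, potential_eq, inner_sub_left, if_neg (Nat.succ_ne_zero l), zero_add,
    add_sub_assoc]

/-- Distinct hidden vectors are nearly orthogonal. -/
def NearlyOrthogonal (e : Fin k → Fin d → Bool) : Prop :=
  ∀ a b : Fin k, a ≠ b → |inner ℝ (signVec (e a)) (signVec (e b))| ≤ 1 / (2 * k)

theorem norm_sum_smul_hiddenVec_succ_sq_le (hd : 0 < d) (hk : 0 < k) {e : Fin k → Fin d → Bool}
    (he : NearlyOrthogonal e) {t : Finset ℕ} (ht : t ⊆ Finset.range k) (c : ℕ → ℝ) :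
    ‖∑ l ∈ t, c l • hiddenVec e (l + 1)‖ ^ 2 ≤ 3 / 2 * ∑ l ∈ t, c l ^ 2 := by
  have hk' : (0 : ℝ) < k := by exact_mod_cast hk
  have hlt : ∀ l ∈ t, l < k := fun l hl => Finset.mem_range.1 (ht hl)
  have hcard : (t.card : ℝ) ≤ k := by
    exact_mod_cast (Finset.card_le_card ht).trans (by simp)
  have h := abs_norm_sum_smul_sq_sub_le (t := t) (v := fun l => hiddenVec e (l + 1))
    (γ := 1 / (2 * k))
    (fun l hl => by simp [hiddenVec, hlt l hl, norm_signVec hd])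
    (fun l hl m hm hlm => by
      simp only [hiddenVec, hlt l hl, hlt m hm, dif_pos]
      exact he _ _ (by simpa using hlm))
    (by positivity) (by
      calc (t.card : ℝ) * (1 / (2 * k)) ≤ k * (1 / (2 * k)) := by gcongr
        _ = 1 / 2 := by field_simp) c
  linarith [(abs_le.1 h).2]

theorem norm_sum_smul_hiddenVec_sq_le (hd : 0 < d) (hk : 0 < k) {e : Fin k → Fin d → Bool}
    (he : NearlyOrthogonal e) {t : Finset ℕ} (ht : t ⊆ Finset.range k) (c : ℕ → ℝ) :
    ‖∑ l ∈ t, c l • hiddenVec e l‖ ^ 2 ≤ 3 / 2 * ∑ l ∈ t, c l ^ 2 := by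
  classical
  have h0 : (t.erase 0).image Nat.pred ⊆ Finset.range k := by
    intro l hl
    obtain ⟨m, hm, rfl⟩ := Finset.mem_image.1 hl
    have := Finset.mem_range.1 (ht (Finset.mem_of_mem_erase hm))
    exact Finset.mem_range.2 (by simp; omega)
  have hinj : Set.InjOn Nat.pred (t.erase 0 : Set ℕ) := by
    intro l hl m hm hlm
    simp at hl hm hlm
    omega
  have h1 := norm_sum_smul_hiddenVec_succ_sq_le hd hk he h0 fun l => c (l + 1)
  rw [Finset.sum_image hinj, Finset.sum_image hinj] at h1
  have hpred : ∀ l ∈ t.erase 0, Nat.pred l + 1 = l := fun l hl => by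
    have := Finset.ne_of_mem_erase hl
    simp; omega
  rw [Finset.sum_congr rfl fun l hl => by rw [hpred l hl],
    Finset.sum_congr (g := fun l => c l ^ 2) rfl fun l hl => by rw [hpred l hl]] at h1
  have h2 : ∑ l ∈ t.erase 0, c l • hiddenVec e l = ∑ l ∈ t, c l • hiddenVec e l :=
    Finset.sum_erase _ (by simp [hiddenVec])
  rw [h2] at h1
  refine h1.trans (mul_le_mul_of_nonneg_left ?_ (by norm_num))
  exact Finset.sum_le_sum_of_subset_of_nonneg (Finset.erase_subset _ _) fun _ _ _ => sq_nonneg _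

/-- By the parallelogram law, 2(3/2 + 3/2) = 6. -/
theorem norm_sum_smul_link_sq_le (hd : 0 < d) (hk : 0 < k) {e : Fin k → Fin d → Bool}
    (he : NearlyOrthogonal e) {t : Finset ℕ} (ht : t ⊆ Finset.range k) (c : ℕ → ℝ) :
    ‖∑ l ∈ t, c l • (hiddenVec e l - hiddenVec e (l + 1))‖ ^ 2 ≤ 6 * ∑ l ∈ t, c l ^ 2 := by
  have h1 := norm_sum_smul_hiddenVec_succ_sq_le hd hk he ht c
  have h2 := norm_sum_smul_hiddenVec_sq_le hd hk he ht c
  simp only [smul_sub, Finset.sum_sub_distrib]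
  have h3 := parallelogram_law_with_norm ℝ (∑ l ∈ t, c l • hiddenVec e l)
    (∑ l ∈ t, c l • hiddenVec e (l + 1))
  nlinarith [mul_self_nonneg ‖∑ l ∈ t, c l • hiddenVec e l + ∑ l ∈ t, c l • hiddenVec e (l + 1)‖]

theorem isAdmissible_chainFun (hd : 0 < d) (hk : 0 < k) {ω : Hidden N k d}
    (he : NearlyOrthogonal ω.2) {mask : Equiv.Perm (Fin N) → ℕ → Fin N → Prop} {a b : ℝ}
    {φ φ' : ℝ → ℝ} (hφ : IsLink a b φ φ') (h : ℝ) (i : Fin N) {M : ℝ}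
    (hM : ∀ t ⊆ Finset.range k, (∀ l ∈ t, mask ω.1 l i) → (t.card : ℝ) ≤ M) {Lf Lg : ℝ}
    (ha : 0 ≤ a) (hb : 0 ≤ b) (hLf0 : 0 ≤ Lf) (hLf : M * 6 * b ^ 2 ≤ Lf ^ 2) (hLg : 6 * a ≤ Lg) :
    IsAdmissible Lf Lg (chainFun mask φ h k ω i) := by
  classical
  rw [chainFun_eq_sum]
  refine isAdmissible_sum _ (by norm_num : (0 : ℝ) ≤ 6)
    (norm_sum_smul_link_sq_le hd hk he (Finset.filter_subset _ _)) hφ ha hb hLf0 ?_ hLg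
  refine le_trans ?_ hLf
  gcongr
  exact hM _ (Finset.filter_subset _ _) fun l hl => (Finset.mem_filter.1 hl).2

theorem le_gap {R ε : ℝ} {f : Fin N → Euc d → ℝ} (hf : ∀ i x, ‖x‖ ≤ R → 0 ≤ f i x) {x₀ : Euc d}
    (hx₀ : ‖x₀‖ ≤ R) (hfx₀ : ∀ i, f i x₀ = 0) {x : Euc d} (hx : ε ≤ fMax f x) : ε ≤ gap R f x := by
  have h1 : sInf (fMax f '' Metric.closedBall 0 R) ≤ 0 := by
    refine csInf_le ⟨0, ?_⟩ ⟨x₀, by simpa using hx₀, by simp [fMax, hfx₀]⟩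
    rintro _ ⟨y, hy, rfl⟩
    exact Real.iSup_nonneg fun i => hf i y (by simpa using hy)
  rw [gap]
  linarith

theorem chainFun_nonneg {mask : Equiv.Perm (Fin N) → ℕ → Fin N → Prop} {φ : ℝ → ℝ}
    (hφ : ∀ s, 0 ≤ φ s) (h : ℝ) (ω : Hidden N k d) (i : Fin N) (x : Euc d) (j : ℕ) :
    0 ≤ chainFun mask φ h j ω i x := by
  classical
  exact Finset.sum_nonneg fun l _ => by split_ifs <;> simp [hφ]

/-- Unless `x` is correlated with the last hidden vector, the links are long on average. -/
theorem le_sum_link {a b : ℝ} {φ φ' : ℝ → ℝ} (hφ : IsLink a b φ φ') (hk : 0 < k) {h ρ : ℝ}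
    {e : Fin k → Fin d → Bool} {x : Euc d}
    (hx : |inner ℝ (signVec (e ⟨k - 1, Nat.sub_lt hk one_pos⟩)) x| ≤ ρ) :
    φ ((h - ρ) / k) ≤ (1 / k : ℝ) * ∑ l ∈ Finset.range k,
      φ (potential h e x l - potential h e x (l + 1)) := by
  have hk' : (0 : ℝ) < k := by exact_mod_cast hk
  have h1 := hφ.convexOn.map_sum_le (t := Finset.range k) (w := fun _ => (1 / k : ℝ))
    (p := fun l => potential h e x l - potential h e x (l + 1))
    (fun _ _ => by positivity) (by simp; field_simp) (fun _ _ => Set.mem_univ _)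
  simp only [smul_eq_mul, ← Finset.mul_sum] at h1
  refine le_trans (hφ.monotone ?_) h1
  rw [Finset.sum_range_sub']
  have h2 : potential h e x k = inner ℝ (signVec (e ⟨k - 1, Nat.sub_lt hk one_pos⟩)) x := by
    obtain ⟨l, rfl⟩ : ∃ l, k = l + 1 := ⟨k - 1, by omega⟩
    simp [potential]
  rw [h2, potential, div_eq_mul_one_div, mul_comm]
  have := (abs_le.1 hx).2
  gcongr

end Objective

/-! ### Choosing one bad instance, and the two instance families -/

section Instance

variable {N d k : ℕ}

theorem norm_proj_mono {S : Type u} {B B' : Set S} (h : B ⊆ B') (ψ : StateSpace S) :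
    ‖proj B ψ‖ ≤ ‖proj B' ψ‖ := by
  classical
  refine le_of_sq_le_sq (hasSum_le (fun s => ?_) (hasSum_proj B ψ) (hasSum_proj B' ψ))
    (norm_nonneg _)
  by_cases hs : s ∈ B
  · simp [hs, h hs]
  · by_cases hs' : s ∈ B' <;> simp [hs, hs']

/-- An algorithm whose queries split into `n` blocks, each of which enters at most `L` levels,
fails on some instance with nearly orthogonal hidden vectors. -/
theorem exists_hard_instance (hd : 0 < d) (hk : 0 < k) {R ρ : ℝ} (hR : 0 < R) (hρ : 0 ≤ ρ)
    {f : ℕ → Hidden N k d → Fin N → Euc d → ℝ} {p δ : ℝ}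
    (hf : IsHiddenChain R k (Agree (N := N) (k := k) (X := Fin d → Bool)) f p δ)
    {W : Type u} {q : ℕ} (A : QueryAlgorithm N d R W q) {L m n : ℕ} {β : ℝ} (hβ : 0 ≤ β)
    (hblock : ∀ J t, J + L ≤ k → ∀ φ : Hidden N k d → StateSpace (Label N d R W),
      (∀ ω ω', Agree J ω ω' → φ ω = φ ω') → (∀ ω, ‖φ ω‖ = 1) → ∀ s ≤ m,
      totalNorm (fun ω => run A.unitaries (f k ω) t (φ ω) s
        - run A.unitaries (f (J + L) ω) t (φ ω) s) ≤ β * √(Fintype.card (Hidden N k d)))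
    (hn : n * L + 1 ≤ k) (hq : q ≤ n * m)
    (herr : √(escapeProb k d R ρ) + n * β ≤ 1 / 3)
    (hortho : k ^ 2 * (2 * Real.exp (-((1 / (2 * k : ℝ)) ^ 2 * d / 2))) ≤ 1 / 2)
    {Lf Lg ε : ℝ}
    (hval : ∀ ω : Hidden N k d, NearlyOrthogonal ω.2 → (∀ i, IsAdmissible Lf Lg (f k ω i)) ∧
      ∀ x : Euc d, ‖x‖ ≤ R →
        |inner ℝ (signVec (ω.2 ⟨k - 1, Nat.sub_lt hk one_pos⟩)) x| ≤ ρ → ε ≤ gap R (f k ω) x) :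
    ∃ f : Fin N → Euc d → ℝ, (∀ i, IsAdmissible Lf Lg (f i)) ∧
      2 / 3 ≤ A.prob f {x | ε ≤ gap R f x} := by
  classical
  obtain ⟨φ, h1, h2, h3⟩ := hf.exists_approx hβ A.norm_start hblock n (by omega) q hq
  let B : Hidden N k d → Set (Label N d R W) := fun ω =>
    {s | ρ < |inner ℝ (signVec (ω.2 ⟨k - 1, Nat.sub_lt hk one_pos⟩)) (A.output s : Euc d)|}
  have h4 := sum_norm_proj_sq_le (r := Agree (N := N) (k := k) (X := Fin d → Bool) (k - 1))
    (B := B) (escapeProb_nonneg k d R ρ) (fun s =>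
      (rareGiven_exists_lt_abs_inner hd hR hρ (mem_closedBall_zero_iff.1 (A.output s).2)
        (k - 1)).mono le_rfl fun ω hω => ⟨_, le_rfl, hω⟩)
    (fun ω ω' hr => h1 ω ω' (hf.mono_le (by omega) hr)) h2 h3
  have h5 : (√(escapeProb k d R ρ) + n * β) ^ 2 ≤ (1 / 3) ^ 2 :=
    pow_le_pow_left₀ (by positivity) herr 2
  obtain ⟨ω, hω, hmass⟩ : ∃ ω : Hidden N k d, NearlyOrthogonal ω.2 ∧
      ‖proj (B ω) (run A.unitaries (f k ω) 0 A.start q)‖ ^ 2 ≤ 1 / 3 := by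
    by_contra hc
    push Not at hc
    have h0 := rareGiven_not_nearly_orthogonal (N := N) (k := k) hd
      (γ := 1 / (2 * k)) (by positivity)
    obtain ⟨bad, hbad⟩ : ∃ bad : Hidden N k d → Prop, bad = fun ω => ∃ a b : Fin k, a ≠ b ∧
      1 / (2 * k) < |inner ℝ (signVec (ω.2 a)) (signVec (ω.2 b))| := ⟨_, rfl⟩
    rw [← hbad] at h0
    have h6 := h0 (fun _ => 1) (fun _ => zero_le_one) fun _ _ _ => rfl
    rw [Finset.sum_const, Finset.card_univ, nsmul_eq_mul, mul_one] at h6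
    have hcard : (0 : ℝ) < Fintype.card (Hidden N k d) := by exact_mod_cast Fintype.card_pos
    -- If every nearly orthogonal choice had mass above 1/3, averaging this inequality would give 1
    -- ≤ 1/2 + 3·(1/9).
    have h7 : ∑ ω : Hidden N k d, (1 : ℝ) ≤ ∑ ω : Hidden N k d,
        ((if bad ω then (1 : ℝ) else 0)
          + 3 * ‖proj (B ω) (run A.unitaries (f k ω) 0 A.start q)‖ ^ 2) := by
      refine Finset.sum_le_sum fun ω _ => ?_
      by_cases hω : NearlyOrthogonal ω.2
      · have := hc ω hω
        have h8 : (0 : ℝ) ≤ if bad ω then (1 : ℝ) else 0 := by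
          split_ifs <;> norm_num
        linarith
      · rw [if_pos (by simpa [hbad, NearlyOrthogonal] using hω)]
        have := sq_nonneg ‖proj (B ω) (run A.unitaries (f k ω) 0 A.start q)‖
        linarith
    rw [Finset.sum_add_distrib, ← Finset.mul_sum, Finset.sum_const, Finset.card_univ,
      nsmul_eq_mul, mul_one] at h7
    have h8 := h6.trans (mul_le_mul_of_nonneg_right hortho hcard.le)
    have h9 := h4.trans (mul_le_mul_of_nonneg_right h5 hcard.le)
    linarith
  obtain ⟨hadm, hgap⟩ := hval ω hω
  refine ⟨f k ω, hadm, ?_⟩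
  have h6 := A.prob_add_norm_proj_sq (f k ω) {x | ε ≤ gap R (f k ω) x}
  have h7 := norm_proj_mono (B := {s | (A.output s : Euc d) ∉ {x | ε ≤ gap R (f k ω) x}})
    (B' := B ω) (fun s hs => by
      by_contra hc
      exact hs (hgap _ (mem_closedBall_zero_iff.1 (A.output s).2) (not_lt.1 hc)))
    (run A.unitaries (f k ω) 0 A.start q)
  have h8 := pow_le_pow_left₀ (norm_nonneg _) h7 2
  linarith

/-! ### The two ways of distributing the links over the functions -/

/-- Link `l` belongs to the function with the `l`-th hidden index only. -/
def indexMask (σ : Equiv.Perm (Fin N)) (l : ℕ) (i : Fin N) : Prop := ∃ h : l < N, σ ⟨l, h⟩ = i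

theorem indexMask_congr (l : ℕ) (σ σ' : Equiv.Perm (Fin N)) (i : Fin N)
    (h : ∀ m : Fin N, m.val ≤ l → σ m = σ' m) : indexMask σ l i ↔ indexMask σ' l i := by
  simp only [indexMask]
  exact exists_congr fun hl => by rw [h ⟨l, hl⟩ le_rfl]

/-- At most half of the indices have been used before link `j`. The form `k - 1` keeps the case `k =
N = 1`. -/
theorem rareGiven_indexMask (hk : 2 * (k - 1) ≤ N) (j : ℕ) (hj : j < k) (i : Fin N) :
    RareGiven (Agree (N := N) (k := k) (X := Fin d → Bool) j) (2 / N)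
      (fun ω => indexMask ω.1 j i) := by
  have hN : 0 < N := i.pos
  have hjN : j < N := by omega
  refine (rareGiven_index hjN i).mono ?_ fun ω ⟨_, h⟩ => h
  have h1 : 2 * (j : ℝ) ≤ N := by
    have : 2 * j ≤ N := by omega
    exact_mod_cast this
  have h2 : (0 : ℝ) < N := by exact_mod_cast hN
  rw [div_le_div_iff₀ (by linarith) h2]
  linarith

theorem card_le_one_of_indexMask {σ : Equiv.Perm (Fin N)} {i : Fin N} {t : Finset ℕ}
    (h : ∀ l ∈ t, indexMask σ l i) : t.card ≤ 1 := by
  rw [Finset.card_le_one]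
  intro a ha b hb
  obtain ⟨ha', h1⟩ := h a ha
  obtain ⟨hb', h2⟩ := h b hb
  simpa using σ.injective (h1.trans h2.symm)

theorem link_le_fMax_indexMask (hkN : k ≤ N) {φ : ℝ → ℝ} (hφ : ∀ s, 0 ≤ φ s) (h : ℝ)
    (ω : Hidden N k d) (x : Euc d) {l : ℕ} (hl : l < k) :
    φ (potential h ω.2 x l - potential h ω.2 x (l + 1)) ≤ fMax (chainFun indexMask φ h k ω) x := by
  classical
  refine le_trans ?_ (le_ciSup (Set.finite_range _).bddAbove (ω.1 ⟨l, hl.trans_le hkN⟩))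
  rw [chainFun]
  refine le_trans (le_of_eq ?_) (Finset.single_le_sum
    (f := fun l' => if indexMask ω.1 l' (ω.1 ⟨l, hl.trans_le hkN⟩) then
      φ (potential h ω.2 x l' - potential h ω.2 x (l' + 1)) else 0)
    (fun l' _ => by split_ifs <;> simp [hφ]) (Finset.mem_range.2 hl))
  rw [if_pos ⟨hl.trans_le hkN, rfl⟩]

theorem mean_link_le_fMax_indexMask (hk : 0 < k) (hkN : k ≤ N) {φ : ℝ → ℝ} (hφ : ∀ s, 0 ≤ φ s)
    (h : ℝ) (ω : Hidden N k d) (x : Euc d) :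
    1 * ((1 / k : ℝ) * ∑ l ∈ Finset.range k,
      φ (potential h ω.2 x l - potential h ω.2 x (l + 1)))
      ≤ fMax (chainFun indexMask φ h k ω) x := by
  have hk' : (0 : ℝ) < k := by exact_mod_cast hk
  have h1 := Finset.sum_le_card_nsmul (Finset.range k)
    (fun l => φ (potential h ω.2 x l - potential h ω.2 x (l + 1))) _
    fun l hl => link_le_fMax_indexMask hkN hφ h ω x (Finset.mem_range.1 hl)
  rw [Finset.card_range, nsmul_eq_mul] at h1
  rw [one_mul, one_div_mul_eq_div, div_le_iff₀ hk']
  linarith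

theorem mean_link_le_fMax_true (hk : 0 < k) (hN : 0 < N) (φ : ℝ → ℝ) (h : ℝ)
    (ω : Hidden N k d) (x : Euc d) :
    (k : ℝ) * ((1 / k : ℝ) * ∑ l ∈ Finset.range k,
      φ (potential h ω.2 x l - potential h ω.2 x (l + 1)))
      ≤ fMax (chainFun (fun _ _ _ => True) φ h k ω) x := by
  have hk' : (k : ℝ) ≠ 0 := by positivity
  refine le_trans (le_of_eq ?_) (le_ciSup (Set.finite_range _).bddAbove ⟨0, hN⟩)
  rw [← mul_assoc, mul_one_div_cancel hk', one_mul]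
  simp [chainFun]

/-! ### The value of the chain -/

/-- The common correlation of the optimum with the hidden vectors. -/
def height (k : ℕ) (R : ℝ) : ℝ := R / √(2 * k)

/-- Points with correlations below this threshold do not see the links. -/
def threshold (k : ℕ) (R : ℝ) : ℝ := height k R / (8 * k)

theorem height_pos (hk : 0 < k) {R : ℝ} (hR : 0 < R) : 0 < height k R := by
  unfold height; positivity

theorem threshold_pos (hk : 0 < k) {R : ℝ} (hR : 0 < R) : 0 < threshold k R := by
  have := height_pos hk hR
  unfold threshold; positivity

theorem height_sq (R : ℝ) : height k R ^ 2 = R ^ 2 / (2 * k) := by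
  rw [height, div_pow, Real.sq_sqrt (by positivity)]

/-- The Huber function after a dead zone which hides the unknown links. -/
def chainLink (k : ℕ) (R a b s : ℝ) : ℝ := huber a b (s - 2 * threshold k R)

/-- `M` is both the maximal number of links in one function, which limits the slope of a link to
order Lf/√M, and the factor by which `fMax` exceeds the mean link. It is 1 for distinct indices and
`k` when all functions share all links. -/
theorem isAdmissible_and_le_gap (hd : 0 < d) (hk : 0 < k) {R Lf Lg ε M : ℝ} (hR : 0 < R)
    (hLf : 0 < Lf) (hLg : 0 < Lg) (hε : 0 < ε) (hM1 : 0 < M)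
    {mask : Equiv.Perm (Fin N) → ℕ → Fin N → Prop}
    (hM : ∀ (σ : Equiv.Perm (Fin N)) i, ∀ t ⊆ Finset.range k, (∀ l ∈ t, mask σ l i) →
      (t.card : ℝ) ≤ M)
    (hmean : ∀ (φ : ℝ → ℝ), (∀ s, 0 ≤ φ s) → ∀ (ω : Hidden N k d) (x : Euc d),
      M * ((1 / k : ℝ) * ∑ l ∈ Finset.range k,
        φ (potential (height k R) ω.2 x l - potential (height k R) ω.2 x (l + 1)))
        ≤ fMax (chainFun mask φ (height k R) k ω) x)
    (h1 : 1156 * (k : ℝ) ^ 3 ≤ M * (Lf * R / ε) ^ 2) (h2 : 1156 * (k : ℝ) ^ 3 ≤ M * (Lg * R ^ 2 / ε))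
    (ω : Hidden N k d) (hω : NearlyOrthogonal ω.2) :
    (∀ i, IsAdmissible Lf Lg
      (chainFun mask (chainLink k R (Lg / 6) (Lf / (3 * √M))) (height k R) k ω i)) ∧
    ∀ x : Euc d, ‖x‖ ≤ R →
      |inner ℝ (signVec (ω.2 ⟨k - 1, Nat.sub_lt hk one_pos⟩)) x| ≤ threshold k R →
      ε ≤ gap R (chainFun mask (chainLink k R (Lg / 6) (Lf / (3 * √M))) (height k R) k ω) x := by
  classical
  have hk' : (1 : ℝ) ≤ k := by exact_mod_cast hk
  have hsM : 0 < √M := Real.sqrt_pos.2 hM1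
  have hsM2 : √M ^ 2 = M := Real.sq_sqrt hM1.le
  have ha : 0 < Lg / 6 := by positivity
  have hb : 0 < Lf / (3 * √M) := by positivity
  have hlink := (isLink_huber ha hb).comp_sub_const (2 * threshold k R)
  have hnn : ∀ s, 0 ≤ chainLink k R (Lg / 6) (Lf / (3 * √M)) s := fun s => huber_nonneg ha hb _
  have hh := height_pos hk hR
  have hh2 := height_sq (k := k) R
  have ht := threshold_pos hk hR
  refine ⟨fun i => isAdmissible_chainFun hd hk hω hlink _ i (hM ω.1 i) ha.le hb.le hLf.le ?_ ?_,
    fun x hx hxl => ?_⟩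
  · rw [div_pow, mul_pow, hsM2]
    have : M * 6 * (Lf ^ 2 / (3 ^ 2 * M)) = 2 / 3 * Lf ^ 2 := by field_simp; norm_num
    rw [this]
    nlinarith [sq_nonneg Lf]
  · linarith
  · obtain ⟨x₀, hx₀, hx₀n⟩ := exists_inner_eq hk (fun l => norm_signVec hd (ω.2 l)) hω (height k R)
    have hx₀R : ‖x₀‖ ≤ R := by
      refine le_of_sq_le_sq (hx₀n.trans (le_of_eq ?_)) hR.le
      rw [hh2]
      field_simp
    have hpot : ∀ l ≤ k, potential (height k R) ω.2 x₀ l = height k R := by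
      intro l hl
      cases l with
      | zero => rfl
      | succ l => rw [potential, dif_pos (by omega), hx₀]
    refine le_gap (fun i y _ => chainFun_nonneg hnn _ _ _ _ _) hx₀R (fun i => ?_) ?_
    · rw [chainFun]
      refine Finset.sum_eq_zero fun l hl => ?_
      rw [Finset.mem_range] at hl
      rw [hpot l hl.le, hpot (l + 1) hl, sub_self]
      have : chainLink k R (Lg / 6) (Lf / (3 * √M)) 0 = 0 := huber_eq_zero ha hb (by linarith)
      rw [this, ite_self]
    · refine le_trans ?_ ((mul_le_mul_of_nonneg_left
        (le_sum_link (h := height k R) hlink hk hxl) hM1.le).trans (hmean _ hnn ω x))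
      -- The mean link argument is at least h/(2k), and the dead zone uses up h/(4k) of it.
      have hs : height k R / (4 * k) ≤ (height k R - threshold k R) / k - 2 * threshold k R := by
        rw [threshold]
        have e1 : height k R / (8 * k) ≤ height k R / 8 := by gcongr; linarith
        have e2 : (height k R / 2) / k ≤ (height k R - height k R / (8 * k)) / k := by
          gcongr; linarith
        have e3 : (height k R / 2) / k - 2 * (height k R / (8 * k)) = height k R / (4 * k) := by
          field_simp; norm_num
        linarith
      have hs0 : 0 ≤ height k R / (4 * k) := by positivity
      have hs2 : (height k R / (4 * k)) ^ 2 = R ^ 2 / (32 * k ^ 3) := by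
        rw [div_pow, hh2]
        field_simp
        norm_num
      have hhub := (le_huber ha hb hs0).trans ((isLink_huber ha hb).monotone hs)
      refine le_trans ?_ (mul_le_mul_of_nonneg_left hhub hM1.le)
      have hgoal : ε / M * 2 ≤ min (Lg / 6 * (height k R / (4 * k)) ^ 2)
          (Lf / (3 * √M) * (height k R / (4 * k))) := by
        refine le_min ?_ ?_
        · rw [hs2]
          rw [← mul_div_assoc, le_div_iff₀ hε] at h2
          have e : Lg / 6 * (R ^ 2 / (32 * k ^ 3)) = Lg * R ^ 2 / (192 * k ^ 3) := by
            field_simp; norm_num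
          rw [e, le_div_iff₀ (by positivity), div_mul_eq_mul_div, div_mul_eq_mul_div,
            div_le_iff₀ hM1]
          have : 0 < ε * (k : ℝ) ^ 3 := by positivity
          nlinarith
        · refine le_of_sq_le_sq ?_ (by positivity)
          rw [mul_pow (Lf / (3 * √M)), hs2, div_pow Lf, mul_pow 3, hsM2]
          rw [div_pow, ← mul_div_assoc, le_div_iff₀ (by positivity)] at h1
          have e : Lf ^ 2 / (3 ^ 2 * M) * (R ^ 2 / (32 * k ^ 3))
              = (Lf * R) ^ 2 / (288 * M * k ^ 3) := by
            field_simp; norm_num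
          have e' : (ε / M * 2) ^ 2 = 4 * ε ^ 2 / M ^ 2 := by ring
          rw [e, e', div_le_div_iff₀ (by positivity) (by positivity)]
          have : 0 < ε ^ 2 * (k : ℝ) ^ 3 := by positivity
          have h3 : 1152 * (ε ^ 2 * (k : ℝ) ^ 3) ≤ M * (Lf * R) ^ 2 := by linarith
          calc 4 * ε ^ 2 * (288 * M * k ^ 3) = M * (1152 * (ε ^ 2 * (k : ℝ) ^ 3)) := by ring
            _ ≤ M * (M * (Lf * R) ^ 2) := by gcongr
            _ = _ := by ring
      have : ε = M * (ε / M * 2 / 2) := by field_simp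
      rw [this]
      gcongr

theorem chainLink_eq_zero {R a b s : ℝ} (ha : 0 < a) (hb : 0 < b) (hs : s ≤ 2 * threshold k R) :
    chainLink k R a b s = 0 := huber_eq_zero ha hb (by linarith)

theorem escapeProb_threshold_le (hk : 0 < k) {R Y : ℝ} (hR : 0 < R) (hY : 0 < Y)
    (hd : 256 * (k : ℝ) ^ 3 * Real.log Y ≤ d) :
    escapeProb k d R (threshold k R) ≤ 2 * k / Y := by
  have hk' : (0 : ℝ) < k := by exact_mod_cast hk
  have h1 : threshold k R ^ 2 * d / (2 * R ^ 2) = d / (256 * k ^ 3) := by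
    rw [threshold, div_pow, height_sq]
    field_simp
    ring
  have h2 : Real.exp (-(d / (256 * k ^ 3) : ℝ)) ≤ Y⁻¹ := by
    refine le_trans (Real.exp_le_exp.2 (neg_le_neg (a := Real.log Y) ?_)) (le_of_eq ?_)
    swap
    · rw [Real.exp_neg, Real.exp_log hY]
    rw [le_div_iff₀ (by positivity)]
    linarith
  rw [escapeProb, h1]
  calc (k : ℝ) * (2 * Real.exp (-(d / (256 * k ^ 3) : ℝ))) ≤ k * (2 * Y⁻¹) := by gcongr
    _ = _ := by ring

/-- Near-orthogonality is cheaper than staying in the dead zone: the exponents are d/(8k²) and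
d/(256k³). No further condition on the dimension is needed for it. -/
theorem ortho_le_escapeProb (hk : 0 < k) {R : ℝ} (hR : 0 < R) :
    k ^ 2 * (2 * Real.exp (-((1 / (2 * k : ℝ)) ^ 2 * d / 2)))
      ≤ k * escapeProb k d R (threshold k R) := by
  have hk' : (1 : ℝ) ≤ k := by exact_mod_cast hk
  have h1 : threshold k R ^ 2 * d / (2 * R ^ 2) = d / (256 * k ^ 3) := by
    rw [threshold, div_pow, height_sq]
    field_simp
    ring
  have h2 : (d : ℝ) / (256 * k ^ 3) ≤ (1 / (2 * k : ℝ)) ^ 2 * d / 2 := by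
    have : (1 / (2 * k : ℝ)) ^ 2 * d / 2 = d / (8 * k ^ 2) := by field_simp; ring
    rw [this]
    gcongr
    · norm_num
    · norm_num
  rw [escapeProb, h1]
  have h3 := Real.exp_le_exp.2 (neg_le_neg h2)
  calc _ ≤ (k : ℝ) ^ 2 * (2 * Real.exp (-(d / (256 * k ^ 3) : ℝ))) := by gcongr
    _ = _ := by ring

end Instance

/-! ### The hard instances in each parameter regime -/

section Cases

variable {N : ℕ}

theorem mul_sqrt_three_div_le (hN : 0 < N) {m : ℕ} {c : ℝ} (hc : 0 < c) (h : c * m ≤ √(N : ℝ)) :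
    (m : ℝ) * √(3 / N : ℝ) ≤ 1.8 / c := by
  have hN' : (0 : ℝ) < N := by exact_mod_cast hN
  have h1 : √(3 / N : ℝ) * √(N : ℝ) ≤ 1.8 := by
    rw [← Real.sqrt_mul (by positivity), div_mul_cancel₀ _ hN'.ne', Real.sqrt_le_iff]
    norm_num
  have h2 := mul_le_mul_of_nonneg_left h (Real.sqrt_nonneg (3 / N : ℝ))
  rw [le_div_iff₀ hc]
  linarith

/-- The chain whose links belong to distinct functions. -/
theorem exists_hard_instance_indexMask {d k : ℕ} (hd : 0 < d) (hk : 0 < k) (hkN : 2 * k ≤ N + 1)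
    {R ρ h : ℝ} (hR : 0 < R) (hρ : 0 ≤ ρ) {φ : ℝ → ℝ} (hφ : 1 < k → ∀ s ≤ 2 * ρ, φ s = 0)
    (hesc : escapeProb k d R ρ ≤ 1 / N) {W : Type u} {q : ℕ} (A : QueryAlgorithm N d R W q)
    {L m n : ℕ} (hn : n * L + 1 ≤ k) (hq : q ≤ n * m)
    (herr : √(escapeProb k d R ρ) + n * blockError (2 * m * √(3 / N : ℝ))
      (2 * m * √(escapeProb k d R ρ)) L ≤ 1 / 3)
    (hortho : k ^ 2 * (2 * Real.exp (-((1 / (2 * k : ℝ)) ^ 2 * d / 2))) ≤ 1 / 2)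
    {Lf Lg ε : ℝ}
    (hval : ∀ ω : Hidden N k d, NearlyOrthogonal ω.2 →
      (∀ i, IsAdmissible Lf Lg (chainFun indexMask φ h k ω i)) ∧
      ∀ x : Euc d, ‖x‖ ≤ R →
        |inner ℝ (signVec (ω.2 ⟨k - 1, Nat.sub_lt hk one_pos⟩)) x| ≤ ρ →
        ε ≤ gap R (chainFun indexMask φ h k ω) x) :
    ∃ f : Fin N → Euc d → ℝ, (∀ i, IsAdmissible Lf Lg (f i)) ∧
      2 / 3 ≤ A.prob f {x | ε ≤ gap R f x} := by
  have h3 : (3 : ℝ) / N = 2 / N + 1 / N := by ring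
  -- The index probability is relaxed so that, with the escape probability added, the total is
  -- exactly 3/N.
  have hp : (2 : ℝ) / N ≤ 3 / N - escapeProb k d R ρ := by linarith
  have hf := isHiddenChain_chainFun (N := N) (k := k) hd hR hρ indexMask_congr
    (le_trans (by positivity) hp)
    (fun j hj i => (rareGiven_indexMask (by omega) j hj i).mono hp fun _ h => h) hφ h
  rw [sub_add_cancel] at hf
  have hδ := escapeProb_nonneg k d R ρ
  refine exists_hard_instance hd hk hR hρ hf A ?_ (fun J t hJ φ hφ hφ1 s hs =>
    hf.totalNorm_run_sub_le (by positivity) hδ hφ hφ1 t m L k hJ le_rfl s hs) hn hq herr hortho hval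
  clear herr
  induction L with
  | zero => rw [blockError]; positivity
  | succ L ih =>
    have := ih (le_trans (by gcongr; omega) hn)
    rw [blockError]
    positivity

/-- A single hidden linear function. -/
theorem exists_hard_instance_linear (hN : 0 < N) {Lf Lg R ε : ℝ} (hLf : 0 < Lf) (hLg : 0 < Lg)
    (hR : 0 < R) (hε : 0 < ε) (hεLf : ε < Lf * R) :
    ∃ d₀ : ℕ, ∀ d ≥ d₀, ∀ (W : Type u) (q : ℕ) (A : QueryAlgorithm N d R W q),
      35 * (q : ℝ) ≤ √(N : ℝ) →
      ∃ f : Fin N → Euc d → ℝ, (∀ i, IsAdmissible Lf Lg (f i)) ∧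
        2 / 3 ≤ A.prob f {x | ε ≤ gap R f x} := by
  classical
  have hN' : (1 : ℝ) ≤ N := by exact_mod_cast hN
  -- Correlation at most `ρ` forces the value Lf(R - ρ) = ε.
  set ρ := R - ε / Lf with hρ
  have hρ0 : 0 < ρ := by
    rw [hρ, sub_pos, div_lt_iff₀ hLf]
    linarith
  refine ⟨1 + ⌈2 * R ^ 2 / ρ ^ 2 * Real.log (200 * N)⌉₊ + ⌈256 * Real.log 4⌉₊,
    fun d hd W q A hq => ?_⟩
  have hd0 : 0 < d := by omega
  have hd1 : 2 * R ^ 2 / ρ ^ 2 * Real.log (200 * N) ≤ d :=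
    (Nat.le_ceil _).trans (Nat.cast_le.2 (by omega))
  have hd2 : 256 * Real.log 4 ≤ d := (Nat.le_ceil _).trans (Nat.cast_le.2 (by omega))
  have hesc : escapeProb 1 d R ρ ≤ 1 / (100 * N) := by
    have h1 : Real.log (200 * N) ≤ ρ ^ 2 * d / (2 * R ^ 2) := by
      rw [div_mul_eq_mul_div, div_le_iff₀ (by positivity)] at hd1
      rw [le_div_iff₀ (by positivity)]
      linarith
    have h2 : Real.exp (-(ρ ^ 2 * d / (2 * R ^ 2))) ≤ (200 * N : ℝ)⁻¹ := by
      refine le_trans (Real.exp_le_exp.2 (neg_le_neg h1)) (le_of_eq ?_)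
      rw [Real.exp_neg, Real.exp_log (by positivity)]
    rw [escapeProb]
    push_cast
    calc (1 : ℝ) * (2 * Real.exp (-(ρ ^ 2 * d / (2 * R ^ 2)))) ≤ 1 * (2 * (200 * N : ℝ)⁻¹) := by
          gcongr
      _ = _ := by field_simp; norm_num
  -- Orthogonality is vacuous for one vector, but the general argument still asks for this
  -- inequality; the second ceiling in `d₀` provides it.
  have hortho : ((1 : ℕ) : ℝ) ^ 2 * (2 * Real.exp (-((1 / (2 * (1 : ℕ) : ℝ)) ^ 2 * d / 2)))
      ≤ 1 / 2 := by
    refine (ortho_le_escapeProb one_pos hR).trans ?_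
    have := escapeProb_threshold_le (d := d) one_pos hR (Y := 4) (by norm_num) (by simpa using hd2)
    norm_num at this ⊢
    linarith
  have hsq : √(escapeProb 1 d R ρ) ≤ 0.1 := by
    rw [Real.sqrt_le_iff]
    refine ⟨by norm_num, hesc.trans ?_⟩
    rw [div_le_iff₀ (by positivity)]
    norm_num
    linarith
  refine exists_hard_instance_indexMask (k := 1) (L := 0) (m := q) (n := 1) (h := R)
    (φ := fun s => Lf * s) hd0 one_pos (by omega) hR hρ0.le (fun h => absurd h (lt_irrefl _)) ?_ A
    (by simp) (by simp) ?_ hortho fun ω _ => ⟨fun i => ?_, fun x hx hxl => ?_⟩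
  · refine hesc.trans ?_
    rw [div_le_div_iff₀ (by positivity) (by positivity)]
    linarith
  · have := mul_sqrt_three_div_le hN (m := q) (c := 35) (by norm_num) hq
    rw [blockError]
    push_cast
    norm_num at *
    linarith
  · rw [chainFun_eq_sum]
    have hcard : ((Finset.range 1).filter fun l => indexMask ω.1 l i).card ≤ 1 :=
      (Finset.card_filter_le _ _).trans (by simp)
    refine isAdmissible_sum _ zero_le_one (fun y => ?_) (IsLink.linear hLg.le hLf.le) hLg.le hLf.le
      hLf.le ?_ (by simp)
    · rcases Finset.subset_singleton_iff.1
        ((Finset.filter_subset (fun l => indexMask ω.1 l i) (Finset.range 1)).trans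
          (by simp : Finset.range 1 ⊆ {0})) with h | h
      · rw [h]; simp
      · rw [h]
        simp [hiddenVec, norm_smul, norm_signVec hd0]
    · have : (((Finset.range 1).filter fun l => indexMask ω.1 l i).card : ℝ) ≤ 1 := by
        exact_mod_cast hcard
      nlinarith [sq_nonneg Lf]
  · have hf : ∀ i x, chainFun indexMask (fun s => Lf * s) R 1 ω i x
        = if indexMask ω.1 0 i then Lf * (R - inner ℝ (signVec (ω.2 0)) x) else 0 := by
      intro i x
      rw [chainFun, Finset.sum_range_one]
      simp [potential]
    refine le_gap (x₀ := R • signVec (ω.2 0)) (fun i y hy => ?_) ?_ (fun i => ?_) ?_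
    · rw [hf]
      split_ifs
      · refine mul_nonneg hLf.le (sub_nonneg.2 ?_)
        refine (real_inner_le_norm _ _).trans ?_
        rwa [norm_signVec hd0, one_mul]
      · exact le_rfl
    · rw [norm_smul, norm_signVec hd0, mul_one, Real.norm_eq_abs, abs_of_pos hR]
    · rw [hf, real_inner_smul_right, real_inner_self_eq_norm_sq, norm_signVec hd0]
      simp
    · refine le_trans ?_ (le_ciSup (Set.finite_range _).bddAbove (ω.1 ⟨0, hN⟩))
      rw [hf, if_pos ⟨hN, rfl⟩]
      have h1 : inner ℝ (signVec (ω.2 0)) x ≤ ρ := (abs_le.1 hxl).2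
      have h2 : Lf * (ε / Lf) = ε := by field_simp
      nlinarith

/-- All functions equal to the sum of all links. -/
theorem exists_hard_instance_sum (hN : 0 < N) {Lf Lg R ε : ℝ} (hLf : 0 < Lf) (hLg : 0 < Lg)
    (hR : 0 < R) (hε : 0 < ε) {k : ℕ} (hk : 0 < k)
    (h1 : 1156 * (k : ℝ) ^ 3 ≤ k * (Lf * R / ε) ^ 2)
    (h2 : 1156 * (k : ℝ) ^ 3 ≤ k * (Lg * R ^ 2 / ε)) :
    ∃ d₀ : ℕ, ∀ d ≥ d₀, ∀ (W : Type u) (q : ℕ) (A : QueryAlgorithm N d R W q), q < k →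
      ∃ f : Fin N → Euc d → ℝ, (∀ i, IsAdmissible Lf Lg (f i)) ∧
        2 / 3 ≤ A.prob f {x | ε ≤ gap R f x} := by
  have hk' : (1 : ℝ) ≤ k := by exact_mod_cast hk
  have hk0 : (0 : ℝ) < k := by linarith
  refine ⟨1 + ⌈256 * (k : ℝ) ^ 3 * Real.log (800 * k ^ 3)⌉₊, fun d hd W q A hq => ?_⟩
  have hd0 : 0 < d := by omega
  have hd1 : 256 * (k : ℝ) ^ 3 * Real.log (800 * k ^ 3) ≤ d :=
    (Nat.le_ceil _).trans (Nat.cast_le.2 (by omega))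
  have hesc := escapeProb_threshold_le hk hR (by positivity) hd1
  have hesc' : escapeProb k d R (threshold k R) ≤ (1 / (20 * k)) ^ 2 := by
    refine hesc.trans (le_of_eq ?_)
    field_simp
    norm_num
  have hsq : √(escapeProb k d R (threshold k R)) ≤ 1 / (20 * k) := by
    rw [Real.sqrt_le_iff]
    exact ⟨by positivity, hesc'⟩
  have hρ := threshold_pos hk hR
  have hsk : 0 < √(k : ℝ) := Real.sqrt_pos.2 hk0
  have hf := isHiddenChain_chainFun (N := N) (k := k) hd0 hR hρ.le
    (mask := fun _ _ _ => True) (p := 1) (fun _ _ _ _ _ => Iff.rfl) zero_le_one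
    (fun j _ i G _ _ => by simp)
    (φ := chainLink k R (Lg / 6) (Lf / (3 * √(k : ℝ))))
    (fun _ s hs => chainLink_eq_zero (by positivity) (by positivity) hs) (height k R)
  have hδ := escapeProb_nonneg k d R (threshold k R)
  have hsq0 := Real.sqrt_nonneg (escapeProb k d R (threshold k R))
  -- No index is hidden, so the next link is visible at once. Blocks are single queries revealing
  -- one link each, and only `far` is used.
  refine exists_hard_instance hd0 hk hR hρ.le hf A (L := 1) (m := 1) (n := q)
    (β := 2 * √(escapeProb k d R (threshold k R))) (by positivity)
    (fun J t hJ φ hφ hφ1 s hs => ?_) (by omega) (by omega) ?_ ?_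
    (isAdmissible_and_le_gap hd0 hk hR hLf hLg hε hk0 (fun _ _ t ht _ => ?_)
      (fun φ _ ω x => mean_link_le_fMax_true hk hN φ _ ω x) h1 h2)
  · refine (totalNorm_run_sub_le _ t φ 1 (fun s hs => ?_) s hs).trans
      (mul_le_of_le_one_left (by positivity) (by exact_mod_cast hs))
    obtain rfl : s = 0 := by omega
    have := totalNorm_oracle_sub_le (R := R) (W := W) hδ (hf.far J k hJ le_rfl) hφ
    rwa [totalNorm_of_norm_eq_one hφ1] at this
  · have hqk : (q : ℝ) ≤ k := by exact_mod_cast hq.le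
    have e1 : (q : ℝ) * (2 * √(escapeProb k d R (threshold k R))) ≤ k * (2 * (1 / (20 * k))) := by
      gcongr
    have e2 : (k : ℝ) * (2 * (1 / (20 * k))) = 1 / 10 := by field_simp; norm_num
    have e3 : (1 : ℝ) / (20 * k) ≤ 1 / 20 := by
      gcongr
      linarith
    linarith
  · refine (ortho_le_escapeProb hk hR).trans ?_
    calc (k : ℝ) * escapeProb k d R (threshold k R) ≤ k * (1 / (20 * k)) ^ 2 := by gcongr
      _ = 1 / (400 * k) := by field_simp; norm_num
      _ ≤ 1 / 400 := by gcongr; linarith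
      _ ≤ 1 / 2 := by norm_num
  · exact_mod_cast (Finset.card_le_card ht).trans (by simp)

theorem escapeProb_le_of_dimBound_le {d k : ℕ} (hk : 0 < k) (hN : 0 < N) {R τ : ℝ} (hR : 0 < R)
    (hτ : 3 ≤ τ) (hkτ : 3 * (k : ℝ) ≤ τ) (hd : dimBound τ N ≤ d) :
    escapeProb k d R (threshold k R) ≤ (1 / (50 * √(N : ℝ) * τ)) ^ 2 := by
  have hN' : (1 : ℝ) ≤ N := by exact_mod_cast hN
  have hk' : (1 : ℝ) ≤ k := by exact_mod_cast hk
  have hsN : 1 ≤ √(N : ℝ) := Real.one_le_sqrt.2 hN'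
  have hsN2 : √(N : ℝ) ^ 2 = N := Real.sq_sqrt (by linarith)
  set X := 32 * √(N : ℝ) * τ ^ 5 with hX
  have hτ0 : 0 < τ := by linarith
  have hτ1 : 1 ≤ τ := by linarith
  have hτX : τ ≤ X := by
    have : τ ≤ τ ^ 5 := le_self_pow₀ hτ1 (by norm_num)
    calc τ ≤ τ ^ 5 := this
      _ = 1 * 1 * τ ^ 5 := by ring
      _ ≤ _ := by rw [hX]; gcongr; norm_num
  have hX0 : 0 < X := by linarith
  have hlog : 0 ≤ Real.log X := Real.log_nonneg (by linarith)
  -- The cube turns 256k³ into 768k³, which is at most 32τ³ because 3k ≤ τ.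
  have h1 : 256 * (k : ℝ) ^ 3 * Real.log (X ^ 3) ≤ d := by
    rw [dimBound] at hd
    rw [Real.log_pow]
    have h2 : (3 * (k : ℝ)) ^ 3 ≤ τ ^ 3 := by gcongr
    have h3 : 768 * (k : ℝ) ^ 3 ≤ 32 * τ ^ 3 := by nlinarith [pow_pos hτ0 3]
    have h4 := mul_le_mul_of_nonneg_right h3 hlog
    push_cast
    linarith
  refine (escapeProb_threshold_le hk hR (by positivity) h1).trans ?_
  have h2 : 2500 * N * τ ^ 2 ≤ X ^ 2 := by
    have : (3 : ℝ) ^ 8 ≤ τ ^ 8 := by gcongr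
    have h3 : X ^ 2 = 1024 * N * τ ^ 2 * τ ^ 8 := by
      rw [hX, mul_pow, mul_pow, hsN2]; ring
    rw [h3]
    have h4 : 0 < N * τ ^ 2 := by positivity
    nlinarith
  have h3 : (1 / (50 * √(N : ℝ) * τ)) ^ 2 = 1 / (2500 * N * τ ^ 2) := by
    rw [div_pow, mul_pow, mul_pow, hsN2]; norm_num
  rw [h3, div_le_div_iff₀ (by positivity) (by positivity), one_mul]
  calc 2 * (k : ℝ) * (2500 * N * τ ^ 2) ≤ X * X ^ 2 := by gcongr; linarith
    _ = _ := by ring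

/-- The chain with Huber links and distinct indices, in the dimension of the theorem. -/
theorem exists_hard_instance_of_dimBound_le {d k : ℕ} (hk : 0 < k) {Lf Lg R ε T : ℝ} (hLf : 0 < Lf)
    (hLg : 0 < Lg) (hR : 0 < R) (hε : 0 < ε) (hT1 : T ^ 3 ≤ (Lf * R / ε) ^ 2)
    (hT2 : T ^ 3 ≤ Lg * R ^ 2 / ε) (hT : 15 ≤ T) (hTN : 2 * (T / 5) ≤ N) (hkT : 15 * (k : ℝ) ≤ T)
    (hd : dimBound (T / 5) N ≤ d) {W : Type u} {q : ℕ} (A : QueryAlgorithm N d R W q)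
    {L m n : ℕ} (hn : n * L + 1 ≤ k) (hq : q ≤ n * m)
    (herr : ∀ δ : ℝ, 0 ≤ δ → δ ≤ 1 / 50 → 10 * δ * √(N : ℝ) * T ≤ 1 →
      δ + n * blockError (2 * m * √(3 / N : ℝ)) (2 * m * δ) L ≤ 1 / 3) :
    ∃ f : Fin N → Euc d → ℝ, (∀ i, IsAdmissible Lf Lg (f i)) ∧
      2 / 3 ≤ A.prob f {x | ε ≤ gap R f x} := by
  have hNpos : (0 : ℝ) < N := by linarith
  have hN : 0 < N := by exact_mod_cast hNpos
  have hN' : (1 : ℝ) ≤ N := by exact_mod_cast hN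
  have hk' : (1 : ℝ) ≤ k := by exact_mod_cast hk
  have hsN : 1 ≤ √(N : ℝ) := Real.one_le_sqrt.2 hN'
  have hsN2 : √(N : ℝ) ^ 2 = N := Real.sq_sqrt (by linarith)
  have hesc := escapeProb_le_of_dimBound_le hk hN hR (τ := T / 5) (by linarith) (by linarith) hd
  have hb : 1 / (50 * √(N : ℝ) * (T / 5)) = 1 / (10 * √(N : ℝ) * T) := by ring
  rw [hb] at hesc
  have hsq : √(escapeProb k d R (threshold k R)) ≤ 1 / (10 * √(N : ℝ) * T) := by
    rw [Real.sqrt_le_iff]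
    exact ⟨by positivity, hesc⟩
  have hbT : (1 : ℝ) / (10 * √(N : ℝ) * T) ≤ 1 / 50 := by
    gcongr
    nlinarith
  have hd0 : 0 < d := by
    have : (0 : ℝ) < d := by
      refine lt_of_lt_of_le ?_ hd
      rw [dimBound]
      have h5 : (1 : ℝ) ≤ (T / 5) ^ 5 := one_le_pow₀ (by linarith)
      have : 0 ≤ Real.log (32 * √(N : ℝ) * (T / 5) ^ 5) := Real.log_nonneg (by nlinarith)
      positivity
    exact_mod_cast this
  have hρ := threshold_pos hk hR
  have hkN : 2 * k ≤ N := by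
    have : 2 * (k : ℝ) ≤ N := by linarith
    exact_mod_cast this
  have ha : 0 < Lg / 6 := by positivity
  have hb' : 0 < Lf / (3 * √(1 : ℝ)) := by positivity
  have hk3 : 1156 * (k : ℝ) ^ 3 ≤ T ^ 3 := by
    have : (15 * (k : ℝ)) ^ 3 ≤ T ^ 3 := by gcongr
    nlinarith [pow_pos (show (0 : ℝ) < k by linarith) 3]
  refine exists_hard_instance_indexMask hd0 hk (by omega) hR hρ.le
    (fun _ s hs => chainLink_eq_zero ha hb' hs) ?_ A hn hq
    (herr _ (Real.sqrt_nonneg _) (hsq.trans hbT) ?_) ?_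
    (isAdmissible_and_le_gap hd0 hk hR hLf hLg hε one_pos
      (fun _ _ t _ ht => by exact_mod_cast card_le_one_of_indexMask ht)
      (fun φ hφ ω x => mean_link_le_fMax_indexMask hk (by omega) hφ _ ω x)
      (by linarith) (by linarith))
  · refine hesc.trans ?_
    rw [div_pow, mul_pow, mul_pow, hsN2, one_pow]
    have hT2 : 1 ≤ T ^ 2 := one_le_pow₀ (by linarith)
    exact one_div_le_one_div_of_le hNpos (by nlinarith)
  · rw [le_div_iff₀ (by positivity)] at hsq
    linarith
  · refine (ortho_le_escapeProb hk hR).trans ?_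
    calc (k : ℝ) * escapeProb k d R (threshold k R)
        ≤ T * (1 / (10 * √(N : ℝ) * T)) ^ 2 :=
          mul_le_mul (by linarith) hesc (escapeProb_nonneg _ _ _ _) (by linarith)
      _ = 1 / (100 * √(N : ℝ) ^ 2 * T) := by field_simp; norm_num
      _ ≤ 1 / (100 * 1 ^ 2 * 15) := by gcongr
      _ ≤ 1 / 2 := by norm_num

/-- `L` is about 4 log T, so that 2^{-L} ≤ T^{-2} as log 2 > 1/2; `m` is about √N/8, which makes θ <
1/2; `n` is about T/(15L). The lower bound on `T` ensures that `n` and `m` are nonzero, so rounding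
down loses at most a factor 2 in each. -/
theorem exists_block_parameters {T K : ℝ} (hT : 40000 ≤ T) (hTN : 2 * (T / 5) ≤ N)
    (hK : 4 * Real.log T + 4 ≤ K) :
    ∃ L m n : ℕ, 15 * ((n * L + 1 : ℕ) : ℝ) ≤ T ∧ √(N : ℝ) * T / (1024 * K) ≤ n * m ∧
      8 * (m : ℝ) ≤ √(N : ℝ) ∧ 15 * (n : ℝ) ≤ T ∧ (1 / 2 : ℝ) ^ L ≤ 1 / T ^ 2 := by
  have hT0 : 0 < T := by linarith
  have hsT0 : 0 ≤ √T := Real.sqrt_nonneg T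
  have hsT2 : √T ^ 2 = T := Real.sq_sqrt hT0.le
  have hsT : 200 ≤ √T := by
    rw [Real.le_sqrt' (by norm_num)]
    linarith
  have hlog : Real.log T ≤ 2 * √T := by
    have h := Real.log_le_sub_one_of_pos (show 0 < √T by linarith)
    rw [Real.log_sqrt hT0.le] at h
    linarith
  have hlog0 : 0 ≤ Real.log T := Real.log_nonneg (by linarith)
  set L := ⌈4 * Real.log T + 4⌉₊ with hL
  have hL1 : 4 * Real.log T + 4 ≤ L := Nat.le_ceil _
  have hL2 : (L : ℝ) < 4 * Real.log T + 4 + 1 := Nat.ceil_lt_add_one (by linarith)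
  have hL0 : (0 : ℝ) < L := by linarith
  set y := (T / 15 - 1) / L with hy
  have hy1 : 1 ≤ y := by
    rw [hy, le_div_iff₀ hL0]
    nlinarith
  have hsN : 8 ≤ √(N : ℝ) := by
    rw [Real.le_sqrt' (by norm_num)]
    linarith
  have hn1 : (⌊y⌋₊ : ℝ) ≤ y := Nat.floor_le (by linarith)
  have hn2 : y / 2 ≤ ⌊y⌋₊ := by
    have h1 := Nat.lt_floor_add_one y
    have h2 : (1 : ℝ) ≤ ⌊y⌋₊ := by exact_mod_cast Nat.one_le_floor_iff y |>.2 hy1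
    linarith
  have hm1 : (⌊√(N : ℝ) / 8⌋₊ : ℝ) ≤ √(N : ℝ) / 8 := Nat.floor_le (by positivity)
  have hm2 : √(N : ℝ) / 16 ≤ ⌊√(N : ℝ) / 8⌋₊ := by
    have h1 := Nat.lt_floor_add_one (√(N : ℝ) / 8)
    have h2 : (1 : ℝ) ≤ ⌊√(N : ℝ) / 8⌋₊ := by
      exact_mod_cast Nat.one_le_floor_iff _ |>.2 (by linarith)
    linarith
  have hyL : y * L = T / 15 - 1 := by rw [hy]; field_simp
  refine ⟨L, ⌊√(N : ℝ) / 8⌋₊, ⌊y⌋₊, ?_, ?_, by linarith, ?_, ?_⟩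
  · push_cast
    nlinarith
  · have hK0 : 0 < K := by linarith
    have h1 : T / (32 * K) ≤ y := by
      rw [hy, div_le_div_iff₀ (by positivity) hL0]
      have h2 : (L : ℝ) ≤ 2 * K := by linarith
      have h3 : T * L ≤ T * (2 * K) := by gcongr
      nlinarith
    calc √(N : ℝ) * T / (1024 * K) = (T / (32 * K) / 2) * (√(N : ℝ) / 16) := by
          field_simp; norm_num
      _ ≤ (y / 2) * (√(N : ℝ) / 16) := by gcongr
      _ ≤ _ := by gcongr
  · have : y * 1 ≤ y * L := by gcongr; linarith
    linarith
  · have h1 : (1 / 2 : ℝ) ≤ Real.exp (-(1 / 2)) := by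
      have := Real.add_one_le_exp (-(1 / 2) : ℝ)
      linarith
    have h2 : (1 / 2 : ℝ) = Real.exp (-Real.log 2) := by
      rw [Real.exp_neg, Real.exp_log (by norm_num)]; norm_num
    rw [h2, ← Real.exp_nat_mul]
    have h3 : 1 / T ^ 2 = Real.exp (-(2 * Real.log T)) := by
      rw [Real.exp_neg, ← Real.log_rpow hT0, Real.exp_log (by positivity)]
      norm_num
    rw [h3]
    refine Real.exp_le_exp.2 ?_
    have := Real.log_two_gt_d9
    nlinarith

end Cases

/-! ### The chain length and the final case distinction -/

theorem chainLength_bounds {Lf Lg R ε : ℝ} (hε : 0 < ε) (hLf : ε < Lf * R) (hLg : ε < Lg * R ^ 2) :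
    1 < chainLength Lf Lg R ε ∧ chainLength Lf Lg R ε ^ 3 ≤ (Lf * R / ε) ^ 2 ∧
      chainLength Lf Lg R ε ^ 3 ≤ Lg * R ^ 2 / ε := by
  have h1 : 1 < Lf * R / ε := (one_lt_div hε).2 hLf
  have h2 : 1 < Lg * R ^ 2 / ε := (one_lt_div hε).2 hLg
  have h3 : 1 < chainLength Lf Lg R ε :=
    lt_min (Real.one_lt_rpow h1 (by norm_num)) (Real.one_lt_rpow h2 (by norm_num))
  refine ⟨h3, ?_, ?_⟩
  · refine (pow_le_pow_left₀ (zero_lt_one.trans h3).le (min_le_left _ _) 3).trans (le_of_eq ?_)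
    rw [← Real.rpow_natCast, ← Real.rpow_mul (by linarith), ← Real.rpow_natCast]
    norm_num
  · refine (pow_le_pow_left₀ (zero_lt_one.trans h3).le (min_le_right _ _) 3).trans (le_of_eq ?_)
    rw [← Real.rpow_natCast, ← Real.rpow_mul (by linarith)]
    norm_num

end MinMaxLower
end

theorem theorem4 :
    ∃ C : ℝ, 0 < C ∧
      ∀ Lf Lg R ε : ℝ, 0 < Lf → 0 < Lg → 0 < R → 0 < ε → ε < min (Lf * R) (Lg * R ^ 2) →
      ∀ N : ℕ, 1 ≤ N →
      ∃ d₀ : ℕ,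
        (3 ≤ MinMaxLower.chainLength Lf Lg R ε / 5 →
          2 * (MinMaxLower.chainLength Lf Lg R ε / 5) ≤ N →
          d₀ = ⌈MinMaxLower.dimBound (MinMaxLower.chainLength Lf Lg R ε / 5) N⌉₊) ∧
        ∀ d : ℕ, d₀ ≤ d →
        ∀ (W : Type u) (q : ℕ) (A : MinMaxLower.QueryAlgorithm N d R W q),
          (q : ℝ) < C * √(N : ℝ) * MinMaxLower.chainLength Lf Lg R ε /
            MinMaxLower.logFactor (MinMaxLower.chainLength Lf Lg R ε) N ^ 2 →
          ∃ f : Fin N → MinMaxLower.Euc d → ℝ,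
            (∀ i, MinMaxLower.IsAdmissible Lf Lg (f i)) ∧
            2 / 3 ≤ A.prob f {x | ε ≤ MinMaxLower.gap R f x} := by
  refine ⟨1 / 10 ^ 6, by norm_num, fun Lf Lg R ε hLf hLg hR hε hmin N hN => ?_⟩
  obtain ⟨hT1, hTf, hTg⟩ := MinMaxLower.chainLength_bounds (Lf := Lf) (Lg := Lg) (R := R) hε
    (hmin.trans_le (min_le_left _ _)) (hmin.trans_le (min_le_right _ _))
  set T := MinMaxLower.chainLength Lf Lg R ε
  have hT0 : 0 < T := by linarith
  have hN' : (1 : ℝ) ≤ N := by exact_mod_cast hN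
  have hsN : 1 ≤ √(N : ℝ) := Real.one_le_sqrt.2 hN'
  have hlogT : 0 ≤ Real.log T := Real.log_nonneg hT1.le
  have hlogN : 0 ≤ Real.log N := Real.log_nonneg hN'
  have hK : 4 * Real.log T + 4 ≤ MinMaxLower.logFactor T N := by
    rw [MinMaxLower.logFactor]; linarith
  set K := MinMaxLower.logFactor T N
  have hK4 : 4 ≤ K := by linarith
  -- the number of queries is less than `√N T / (10⁶ K)`
  have hquery : 1 / 10 ^ 6 * √(N : ℝ) * T / K ^ 2 ≤ √(N : ℝ) * T / (10 ^ 6 * K) := by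
    rw [div_le_div_iff₀ (by positivity) (by positivity)]
    have h1 : K * (√(N : ℝ) * T) ≤ K ^ 2 * (√(N : ℝ) * T) := by gcongr; nlinarith
    linarith
  have hquery' : √(N : ℝ) * T / (10 ^ 6 * K) ≤ √(N : ℝ) * T / (4 * 10 ^ 6) :=
    div_le_div_of_nonneg_left (by positivity) (by positivity) (by linarith)
  rcases lt_or_ge T 15 with hT15 | hT15
  · obtain ⟨d₀, hd₀⟩ := MinMaxLower.exists_hard_instance_linear.{u} hN hLf hLg hR hε
      (hmin.trans_le (min_le_left _ _))
    refine ⟨d₀, fun h => by linarith, fun d hd W q A hq => hd₀ d hd W q A ?_⟩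
    have h1 : √(N : ℝ) * T / (4 * 10 ^ 6) ≤ √(N : ℝ) * 15 / (4 * 10 ^ 6) := by gcongr
    linarith
  rcases lt_or_ge (N : ℝ) (2 * (T / 5)) with hTN | hTN
  · have hsT2 : √T ^ 2 = T := Real.sq_sqrt hT0.le
    have hsT : 3 ≤ √T := by
      rw [Real.le_sqrt' (by norm_num)]
      linarith
    -- With all links in one function the constraints read 1156k² ≤ T³, and 1156 = 34². Since N <
    -- 2T/5, this `k` exceeds the query budget.
    set k := ⌊T * √T / 34⌋₊
    have hk1 : (k : ℝ) ≤ T * √T / 34 := Nat.floor_le (by positivity)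
    have hk2 := Nat.lt_floor_add_one (T * √T / 34)
    have hk0 : 0 < k := Nat.floor_pos.2 (by nlinarith)
    have hk0' : (1 : ℝ) ≤ k := by exact_mod_cast hk0
    have hk3 : 1156 * (k : ℝ) ^ 3 ≤ k * T ^ 3 := by
      have h1 : (34 * (k : ℝ)) ^ 2 ≤ (T * √T) ^ 2 :=
        pow_le_pow_left₀ (by positivity) (by linarith) 2
      have h2 : (T * √T) ^ 2 = T ^ 3 := by rw [mul_pow, hsT2]; ring
      rw [h2] at h1
      have h3 := mul_le_mul_of_nonneg_left h1 (Nat.cast_nonneg (α := ℝ) k)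
      linarith
    obtain ⟨d₀, hd₀⟩ := MinMaxLower.exists_hard_instance_sum.{u} hN hLf hLg hR hε hk0
      (hk3.trans (by gcongr)) (hk3.trans (by gcongr))
    refine ⟨d₀, fun _ h => by linarith, fun d hd W q A hq => hd₀ d hd W q A ?_⟩
    have h1 : √(N : ℝ) ≤ √T := Real.sqrt_le_sqrt (by linarith)
    have h2 : √(N : ℝ) * T ≤ √T * T := by gcongr
    have h3 : (q : ℝ) < k := by
      have : T * √T / 34 < 2 * k := by
        change _ < (k : ℝ) + 1 at hk2
        linarith
      linarith
    exact_mod_cast h3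
  -- Only in this range is the dimension prescribed; in the previous two cases that clause was
  -- vacuous.
  refine ⟨_, fun _ _ => rfl, fun d hd W q A hq => ?_⟩
  have hd' : MinMaxLower.dimBound (T / 5) N ≤ d := Nat.ceil_le.1 hd
  rcases lt_or_ge T 40000 with hT4 | hT4
  -- For bounded T a search bound of order √N suffices. The linear instance would not do, because
  -- its dimension was not bounded by `dimBound`; a single Huber link is used instead.
  · refine MinMaxLower.exists_hard_instance_of_dimBound_le (k := 1) one_pos hLf hLg hR hε hTf hTg
      hT15 hTN (by simpa using hT15) hd' A (L := 0) (m := q) (n := 1) (by simp) (by simp)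
      fun δ _ hδ _ => ?_
    have h1 : √(N : ℝ) * T / (4 * 10 ^ 6) ≤ √(N : ℝ) * 40000 / (4 * 10 ^ 6) := by gcongr
    have h2 := MinMaxLower.mul_sqrt_three_div_le (N := N) hN (m := q) (c := 35) (by norm_num)
      (by linarith)
    rw [MinMaxLower.blockError]
    push_cast
    norm_num at *
    linarith
  · obtain ⟨L, m, n, hk, hnm, hm, hnT, hL⟩ := MinMaxLower.exists_block_parameters hT4 hTN hK
    have hqnm : q ≤ n * m := by
      have h1 : √(N : ℝ) * T / (10 ^ 6 * K) ≤ √(N : ℝ) * T / (1024 * K) := by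
        gcongr
        norm_num
      have : (q : ℝ) ≤ n * m := by linarith
      exact_mod_cast this
    refine MinMaxLower.exists_hard_instance_of_dimBound_le (k := n * L + 1) (Nat.succ_pos _) hLf hLg
      hR hε hTf hTg hT15 hTN hk hd' A le_rfl hqnm fun δ hδ0 hδ hδT => ?_
    have h2 := MinMaxLower.mul_sqrt_three_div_le (N := N) hN (m := m) (c := 8) (by norm_num) hm
    -- Here θ ≤ 2·1.8/8 = 0.45. Over all blocks the errors 2^{-(L+1)} sum to at most 1/(30T), and
    -- the η-terms to at most T√N δ/30 ≤ 1/300.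
    have h3 := MinMaxLower.blockError_le (θ := 2 * m * √(3 / N : ℝ)) (η := 2 * m * δ)
      (by positivity) (by norm_num at *; linarith) (by positivity) L
    have h4 := mul_le_mul_of_nonneg_left h3 (Nat.cast_nonneg (α := ℝ) n)
    have h5 : (n : ℝ) * (1 / 2) ^ L ≤ T / 15 * (1 / T ^ 2) := by
      gcongr
      linarith
    have h6 : T / 15 * (1 / T ^ 2) = 1 / (15 * T) := by field_simp
    have h7 : 1 / (15 * T) ≤ 1 / (15 * 15) := by gcongr
    have h8 : (n : ℝ) * m * δ ≤ T / 15 * (√(N : ℝ) / 8) * δ := by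
      gcongr <;> linarith
    rw [pow_succ] at h4
    linarith
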